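/- All monoids are abelian and written additively. For a monoid $M$ write $x\le y$ if $x+z=y$ for some $z\in M$; for an idempotent $e\in M$ (that is, $2e=e$) put $G_M[e]=\{x\in M : e\le x\le e\}$, which is a group with zero element $e$. An element $x$ is strongly periodic if $(m+1)x=x$ for some positive integer $m$, and its order is then the least such $m$. A supernatural number is a formal product $\mathfrak{m}=\prod_p p^{t(p)}$ over all primes $p$ with $t(p)\in\{0,1,2,\dots\}\cup\{\infty\}$; $\prod_p p^{s(p)}$ divides $\prod_p p^{t(p)}$ if $s(p)\le t(p)$ for all $p$, and positive integers are regarded as supernatural numbers via their prime factorizations. For a positive integer $n$, $(\mathbb{Z}/n\mathbb{Z})\sqcup\{0\}$ is the monoid obtained from the additive group $\mathbb{Z}/n\mathbb{Z}$ by adjoining a new zero element $0$. Let $\mathfrak{m}$ be a supernatural number and $M$ an abelian monoid. Then $M$ is isomorphic to a direct limit (over a nonempty directed partially ordered set, with monoid homomorphisms as transition maps) of finite direct sums of monoids of the form $(\mathbb{Z}/n\mathbb{Z})\sqcup\{0\}$ with $n$ a positive integer dividing $\mathfrak{m}$ if and only if the following conditions hold: (a) every element of $M$ is strongly periodic; $M$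 is conical, i.e. $x+y=0$ implies $x=y=0$; and $M$ has the Riesz refinement property, i.e. whenever $x_1+x_2=y_1+y_2$ in $M$ there are $z_{ij}\in M$ ($i,j\in\{1,2\}$) with $x_i=z_{i1}+z_{i2}$ and $y_j=z_{1j}+z_{2j}$ for $i,j\in\{1,2\}$; (b) for all idempotents $e\le f$ in $M$, the homomorphism $G_M[e]\to G_M[f]$, $x\mapsto x+f$, is injective, and its image $G_M[e]+f$ is a pure subgroup of $G_M[f]$ (a subgroup $H$ of an abelian group $G$ is pure if $H\cap nG=nH$ for all positive integers $n$); (c) the order of every element of $M$ divides $\mathfrak{m}$. -/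

import Mathlib

universe u

/-- A generalized integer (supernatural number): a formal product `∏ p ^ t(p)` over all primes
`p`, with exponents in `{0, 1, 2, …} ∪ {∞}`; it is given by its exponents. -/
def GeneralizedInteger : Type := Nat.Primes → ℕ∞

namespace GeneralizedInteger

/-- The exponent of the prime `p` in a generalized integer. -/
def exponent (a : GeneralizedInteger) (p : Nat.Primes) : ℕ∞ := a p

/-- `a ∣ b` means that each exponent of `a` is at most the corresponding exponent of `b`. -/
instance : Dvd GeneralizedInteger := ⟨fun a b => ∀ p : Nat.Primes, a.exponent p ≤ b.exponent p⟩

/-- A positive integer, seen as a generalized integer through its prime factorization. -/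
def ofPNat (n : ℕ+) : GeneralizedInteger := fun p => ((n : ℕ).factorization p : ℕ∞)

end GeneralizedInteger

namespace AbelianMonoid

/-- The algebraic preorder: `x ≤ y` if and only if `x + z = y` for some `z`. -/
def AlgLE {M : Type u} [AddCommMonoid M] (x y : M) : Prop := ∃ z : M, x + z = y

/-- `m` is the order of `x`: the smallest positive integer `m` with `(m + 1) x = x`. -/
def HasOrder {M : Type u} [AddCommMonoid M] (x : M) (m : ℕ+) : Prop :=
  IsLeast {k : ℕ+ | ((k : ℕ) + 1) • x = x} m

/-- Every element is strongly periodic: `(m + 1) x = x` for some positive integer `m`. -/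
def IsStronglyPeriodic (M : Type u) [AddCommMonoid M] : Prop :=
  ∀ x : M, ∃ m : ℕ+, ((m : ℕ) + 1) • x = x

def IsConical (M : Type u) [AddCommMonoid M] : Prop :=
  ∀ x y : M, x + y = 0 → x = 0 ∧ y = 0

/-- The Riesz refinement property. -/
def IsRefinement (M : Type u) [AddCommMonoid M] : Prop :=
  ∀ x₁ x₂ y₁ y₂ : M, x₁ + x₂ = y₁ + y₂ → ∃ z₁₁ z₁₂ z₂₁ z₂₂ : M,
    x₁ = z₁₁ + z₁₂ ∧ x₂ = z₂₁ + z₂₂ ∧ y₁ = z₁₁ + z₂₁ ∧ y₂ = z₁₂ + z₂₂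

/-- The elements `e` with `2 e = e`. -/
def IsIdem {M : Type u} [AddCommMonoid M] (e : M) : Prop := e + e = e

/-- `G_M[e] = {x | e ≤ x ≤ e}`. For an idempotent `e` this is a group under the addition of `M`,
with zero element `e`. -/
def component {M : Type u} [AddCommMonoid M] (e : M) : Set M := {x | AlgLE e x ∧ AlgLE x e}

/-- Purity of a subgroup `H` of an abelian group `G`, both being carried by subsets of the monoid
`M` with the addition of `M`: `H ∩ nG = nH` for all positive integers `n`. (Only positive
multiples occur, and these are the same in `G` as in `M`.) -/
def IsPureIn {M : Type u} [AddCommMonoid M] (H G : Set M) : Prop :=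
  H ⊆ G ∧ ∀ n : ℕ, 0 < n → H ∩ (fun y => n • y) '' G = (fun z => n • z) '' H

/-- Strongly periodic conical refinement monoids such that for all idempotents `e ≤ f` the
homomorphism `x ↦ x + f` from `G_M[e]` to `G_M[f]` is injective and its image `G_M[e] + f` is a
pure subgroup of `G_M[f]`. -/
structure IsRep (M : Type u) [AddCommMonoid M] : Prop where
  stronglyPeriodic : IsStronglyPeriodic M
  conical : IsConical M
  refinement : IsRefinement M
  embedding : ∀ e f : M, IsIdem e → IsIdem f → AlgLE e f →
    Set.InjOn (fun x => x + f) (component e)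
  purity : ∀ e f : M, IsIdem e → IsIdem f → AlgLE e f →
    IsPureIn ((fun x => x + f) '' component e) (component f)

/-- The finite direct sum of the monoids `(ℤ/nₖℤ) ⊔ {0}`, `k = 1, …, r`. Here `WithZero (ZMod n)`
is the additive group `ℤ/nℤ` with a new additive identity adjoined. -/
abbrev CyclicSum {r : ℕ} (n : Fin r → ℕ+) : Type := ∀ k : Fin r, WithZero (ZMod (n k : ℕ))

/-- `M` is (isomorphic to) the direct limit, over a nonempty directed partially ordered set, of a
direct system of finite direct sums of monoids `(ℤ/nℤ) ⊔ {0}` with `n` a positive integer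
dividing `𝔪`. -/
def IsDirectLimitOfCyclicSums (𝔪 : GeneralizedInteger) (M : Type u) [AddCommMonoid M] : Prop :=
  ∃ (ι : Type u) (_ : PartialOrder ι) (_ : Nonempty ι) (_ : IsDirectedOrder ι)
    (r : ι → ℕ) (n : ∀ i, Fin (r i) → ℕ+)
    (f : ∀ i j : ι, i ≤ j → CyclicSum (n i) →+ CyclicSum (n j))
    (_ : DirectedSystem (fun i => CyclicSum (n i)) (fun i j h => f i j h)),
    (∀ i k, GeneralizedInteger.ofPNat (n i k) ∣ 𝔪) ∧
      Nonempty (M ≃+ DirectLimit (fun i => CyclicSum (n i)) f)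

end AbelianMonoid

-- From the limit to the conditions: each condition concerns finitely many elements and equations.
-- By `IsDirectLimitOfCyclicSums.exists_stages` these lift to a single cyclic sum, where the
-- solutions are found summand by summand and mapped back to `M`.
--
-- Conversely, in a strongly periodic monoid each element lies in the group around a unique
-- idempotent, its level, and by injectivity in (b) it is determined by its level and its image in
-- the Grothendieck group (`IsRep.ext`). Refinement makes the lattice of ideals of idempotents
-- distributive. Sending an ideal to the subgroup of images of elements with level in it is a
-- lattice homomorphism into pure subgroups. So finitely many elements of `M` become finitely many
-- elements of a torsion group filtered by pure subgroups over a distributive lattice.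
--
-- There `exists_adapted_span` supplies an independent generating family compatible with all these
-- subgroups: cyclic decompositions of successive quotients lift without raising orders, by purity.
-- Consequently every homomorphism from a cyclic sum to `M` factors through another cyclic sum in
-- such a way that the first factor already identifies whatever becomes equal in `M`
-- (`IsRep.exists_factorization`). Hence the category `CyclicOver` of cyclic sums over `M` is
-- filtered, and `M` is its colimit; a final functor from a directed poset turns this into a direct
-- limit.

universe v

namespace AbelianMonoid

/-! ### Independent generators in torsion groups -/

section TorsionGroup

variable {G : Type u} [AddCommGroup G]

/-- A finite set in a torsion abelian group is spanned by an independent finite family of elements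
of the subgroup it generates. -/
theorem exists_independent_span (hG : IsAddTorsion G) (Y : Finset G) :
    ∃ (ι : Type) (_ : Fintype ι) (q : ι → G),
      (∀ i, q i ∈ AddSubgroup.closure (Y : Set G)) ∧
      (∀ c : ι → ℤ, ∑ i, c i • q i = 0 → ∀ i, c i • q i = 0) ∧
      ∀ y ∈ Y, ∃ c : ι → ℤ, ∑ i, c i • q i = y := by
  classical
  let K := AddSubgroup.closure (Y : Set G)
  have hfg : AddGroup.FG K := by
    rw [AddGroup.fg_iff_addSubgroup_fg]
    exact ⟨Y, rfl⟩
  have hfin : Finite K := AddCommGroup.finite_of_fg_isAddTorsion K (by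
    intro x
    obtain ⟨n, hn, h⟩ := isOfFinAddOrder_iff_nsmul_eq_zero.1 (hG x.1)
    exact isOfFinAddOrder_iff_nsmul_eq_zero.2 ⟨n, hn, Subtype.ext (by simpa using h)⟩)
  obtain ⟨ι, hι, p, hp, e, ⟨ψ⟩⟩ := AddCommGroup.equiv_directSum_zmod_of_finite K
  let χ : K ≃+ ∀ i, ZMod (p i ^ e i) := ψ.trans (DirectSum.addEquivProd _)
  have key : ∀ c : ι → ℤ, ∑ i, c i • χ.symm (Pi.single i 1) =
      χ.symm (fun i => (c i : ZMod (p i ^ e i))) := by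
    intro c
    simp_rw [← map_zsmul, ← map_sum]
    congr 1
    ext j
    rw [Finset.sum_apply, Finset.sum_eq_single j]
    · simp
    · intro b _ hb
      simp [Pi.single_eq_of_ne' hb]
    · simp
  have coeK : ∀ c : ι → ℤ, ∑ i, c i • (χ.symm (Pi.single i 1) : G) =
      (χ.symm (fun i => (c i : ZMod (p i ^ e i))) : K) := by
    intro c
    rw [← key]
    push_cast
    rfl
  refine ⟨ι, hι, fun i => χ.symm (Pi.single i 1), fun i => (χ.symm (Pi.single i 1)).2, ?_, ?_⟩
  · intro c hc i
    rw [coeK] at hc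
    have h0 : χ.symm (fun i => (c i : ZMod (p i ^ e i))) = 0 := Subtype.ext hc
    rw [map_eq_zero_iff _ χ.symm.injective] at h0
    have h1 : (c i : ZMod (p i ^ e i)) = 0 := congrFun h0 i
    have : c i • χ.symm (Pi.single i 1) = 0 := by
      rw [← map_zsmul, ← Pi.single_smul, zsmul_one, h1, Pi.single_zero, map_zero]
    simpa using congrArg Subtype.val this
  · intro y hy
    choose c hc using fun i =>
      ZMod.intCast_surjective (χ ⟨y, AddSubgroup.subset_closure hy⟩ i)
    refine ⟨c, ?_⟩
    rw [coeK, funext hc, AddEquiv.symm_apply_apply]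

end TorsionGroup

/-! ### Generators adapted to a lattice of pure subgroups -/

section EssentialMeets

variable {L : Type*} [DistribLattice L] [BoundedOrder L] {κ : Type*} [Fintype κ] [DecidableEq κ]

/-- The meet of the `e k`, `k ∈ T`, is not the join of the meets over larger sets. -/
def EssentialMeet (e : κ → L) (T : Finset κ) : Prop :=
  ¬ T.inf e ≤ (Finset.univ.filter (T ⊂ ·)).sup fun T' => T'.inf e

/-- If `S` missed `T`, distributivity would write `T.inf e` as the join of the meets over `insert l
T`, `l ∈ S`, all strictly larger sets. -/
theorem EssentialMeet.exists_mem {e : κ → L} {T : Finset κ} (hT : EssentialMeet e T) {k : κ}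
    (hk : k ∈ T) {S : Finset κ} (hS : e k ≤ S.sup e) : ∃ l ∈ S, l ∈ T := by
  by_contra! h
  apply hT
  have h1 : T.inf e ≤ T.inf e ⊓ S.sup e := le_inf le_rfl ((Finset.inf_le hk).trans hS)
  rw [Finset.sup_inf_distrib_left] at h1
  refine h1.trans (Finset.sup_le fun l hl => ?_)
  refine le_trans ?_ (Finset.le_sup (b := insert l T) ?_)
  · rw [Finset.inf_insert, inf_comm]
  · simpa using Finset.ssubset_insert (h l hl)

/-- A meet that is not essential is covered by meets over larger sets, so downward induction on `T`
ends at essential ones. -/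
theorem inf_le_sup_essentialMeet (e : κ → L) [DecidablePred (EssentialMeet e)] (T : Finset κ) :
    T.inf e ≤ (Finset.univ.filter fun T' => T ⊆ T' ∧ EssentialMeet e T').sup
      fun T' => T'.inf e := by
  induction T using Finset.strongDownwardInductionOn (n := Fintype.card κ) with
  | H T ih =>
    by_cases hT : EssentialMeet e T
    · exact Finset.le_sup (f := fun T' : Finset κ => T'.inf e) (by simpa using hT)
    · refine (not_not.1 hT).trans (Finset.sup_le fun T' hT' => ?_)
      have hT'' : T ⊂ T' := by simpa using hT'
      refine (ih (Finset.card_le_univ _) hT'').trans (Finset.sup_mono fun T₁ h₁ => ?_)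
      simp only [Finset.mem_filter, Finset.mem_univ, true_and] at h₁ ⊢
      exact ⟨hT''.1.trans h₁.1, h₁.2⟩
  | _ => exact Finset.card_le_univ _

variable {G : Type u} [AddCommGroup G]

/-- Induction over upper sets of index sets, removing one minimal `T` at a time. Generators of the
quotient by the smaller subgroup are lifted into `B (T.inf e)`, and the errors are handled by
induction. -/
theorem exists_adapted_span_of_isUpperSet (hG : IsAddTorsion G) (B : L → AddSubgroup G)
    (hsup : ∀ a b, B (a ⊔ b) = B a ⊔ B b) (hinf : ∀ a b, B (a ⊓ b) = B a ⊓ B b)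
    (hbot : B ⊥ = ⊥)
    (hpure : ∀ a, ∀ n : ℕ, 0 < n → ∀ y, n • y ∈ B a → ∃ z ∈ B a, n • z = n • y)
    (e : κ → L) (N : ℕ) :
    ∀ U : Finset (Finset κ), U.card = N → IsUpperSet (U : Set (Finset κ)) →
    ∀ X : Finset G, (∀ x ∈ X, x ∈ B (U.sup fun T => T.inf e)) →
    ∃ (ι : Type) (_ : Fintype ι) (t : ι → Finset κ) (v : ι → G),
      (∀ j, t j ∈ U) ∧ (∀ j, EssentialMeet e (t j)) ∧ (∀ j, v j ∈ B ((t j).inf e)) ∧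
      (∀ c : ι → ℤ, ∑ j, c j • v j = 0 → ∀ j, c j • v j = 0) ∧
      (∀ k, ∀ c : ι → ℤ, ∑ j, c j • v j ∈ B (e k) → ∀ j, k ∉ t j → c j • v j = 0) ∧
      ∀ x ∈ X, ∃ c : ι → ℤ, ∑ j, c j • v j = x := by
  classical
  have hmono : ∀ a b, a ≤ b → B a ≤ B b := by
    intro a b hab
    rw [← sup_eq_right.2 hab, hsup]
    exact le_sup_left
  induction N with
  | zero =>
    intro U hU _ X hX
    rw [Finset.card_eq_zero] at hU
    subst hU
    refine ⟨Empty, inferInstance, Empty.elim, Empty.elim, fun j => j.elim, fun j => j.elim,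
      fun j => j.elim, fun _ _ j => j.elim, fun _ _ _ j => j.elim, fun x hx => ⟨0, ?_⟩⟩
    have := hX x hx
    rw [Finset.sup_empty, hbot, AddSubgroup.mem_bot] at this
    simp [this]
  | succ N ih =>
    intro U hU hup X hX
    have hne : U.Nonempty := Finset.card_pos.1 (by omega)
    -- Minimal cardinality ensures that erasing `T` leaves an upper set.
    obtain ⟨T, hTU, hTmin⟩ := Finset.exists_min_image U Finset.card hne
    set U' := U.erase T with hU'
    have hcard : U'.card = N := by rw [hU', Finset.card_erase_of_mem hTU, hU]; rfl
    have hup' : IsUpperSet (U' : Set (Finset κ)) := by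
      intro T₁ T₂ h12 h1
      simp only [hU', Finset.coe_erase, Set.mem_sdiff, Finset.mem_coe, Set.mem_singleton_iff]
        at h1 ⊢
      refine ⟨hup h12 h1.1, ?_⟩
      rintro rfl
      exact h1.2 (Finset.eq_of_subset_of_card_le h12 (hTmin _ h1.1))
    have hss : ∀ T', T ⊂ T' → T' ∈ U' := fun T' h =>
      Finset.mem_erase.2 ⟨h.ne', hup h.1 hTU⟩
    have hUeq : U.sup (fun T => T.inf e) = T.inf e ⊔ U'.sup (fun T => T.inf e) := by
      rw [← Finset.insert_erase hTU, Finset.sup_insert]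
    set a := U'.sup (fun T => T.inf e) with ha
    by_cases hT : EssentialMeet e T
    swap
    · have hle : T.inf e ≤ a := (not_not.1 hT).trans
        (Finset.sup_mono fun T' h => hss T' (by simpa using h))
      rw [hUeq, sup_eq_right.2 hle] at hX
      obtain ⟨ι, hι, t, v, h1, h2⟩ := ih U' hcard hup' X hX
      exact ⟨ι, hι, t, v, fun j => Finset.mem_of_mem_erase (h1 j), h2⟩
    rw [hUeq, hsup] at hX
    let π := QuotientAddGroup.mk' (B a)
    have hπ : ∀ g, π g = 0 ↔ g ∈ B a := fun g => QuotientAddGroup.eq_zero_iff g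
    have hQ : IsAddTorsion (G ⧸ B a) := by
      intro q
      obtain ⟨g, rfl⟩ := QuotientAddGroup.mk'_surjective (B a) q
      exact π.isOfFinAddOrder (hG g)
    obtain ⟨ι₁, _, q, hq, hqi, hqs⟩ := exists_independent_span hQ (X.image π)
    have hlift : ∀ i, ∃ b ∈ B (T.inf e), π b = q i ∧ addOrderOf (q i) • b = 0 := by
      intro i
      have : q i ∈ (B (T.inf e) ⊔ B a).map π := by
        refine (AddSubgroup.closure_le _).2 ?_ (hq i)
        intro y hy
        obtain ⟨x, hx, rfl⟩ := Finset.mem_image.1 (Finset.mem_coe.1 hy)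
        exact ⟨x, hX x hx, rfl⟩
      obtain ⟨g, hg, hgq⟩ := this
      obtain ⟨b, hb, l, hl, rfl⟩ := AddSubgroup.mem_sup.1 hg
      rw [map_add, (hπ l).2 hl, add_zero] at hgq
      -- The order of `q i` sends `b` into a pure subgroup; subtracting an element there with the
      -- same multiple gives a lift killed by the order of `q i`.
      have hmem : addOrderOf (q i) • b ∈ B (T.inf e ⊓ a) := by
        rw [hinf]
        refine ⟨AddSubgroup.nsmul_mem _ hb _, ?_⟩
        show _ ∈ B a
        rw [← hπ, map_nsmul, hgq, addOrderOf_nsmul_eq_zero]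
      obtain ⟨z, hz, hzb⟩ := hpure _ _ (hQ (q i)).addOrderOf_pos _ hmem
      rw [hinf] at hz
      refine ⟨b - z, AddSubgroup.sub_mem _ hb hz.1, ?_, ?_⟩
      · rw [map_sub, (hπ z).2 hz.2, sub_zero, hgq]
      · rw [smul_sub, hzb, sub_self]
    choose b hbT hbq hbo using hlift
    have hbind : ∀ c : ι₁ → ℤ, ∑ i, c i • b i ∈ B a → ∀ i, c i • b i = 0 := by
      intro c hc i
      rw [← hπ, map_sum] at hc
      simp only [map_zsmul, hbq] at hc
      have := addOrderOf_dvd_iff_zsmul_eq_zero.2 (hqi c hc i)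
      obtain ⟨m, hm⟩ := this
      rw [hm, mul_comm, mul_smul, natCast_zsmul, hbo, smul_zero]
    have hc1 : ∀ x : X, ∃ c : ι₁ → ℤ, ∑ i, c i • b i - x.1 ∈ B a := by
      intro x
      obtain ⟨c, hc⟩ := hqs (π x.1) (Finset.mem_image_of_mem _ x.2)
      refine ⟨c, ?_⟩
      rw [← hπ, map_sub, map_sum, sub_eq_zero]
      simpa only [map_zsmul, hbq] using hc
    choose c₁ hc₁ using hc1
    obtain ⟨ι₂, _, t, v, htU, hess, hv, hind, hadp, hspan⟩ := ih U' hcard hup'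
      (Finset.univ.image fun x : X => ∑ i, c₁ x i • b i - x.1) (by
        intro y hy
        obtain ⟨x, _, rfl⟩ := Finset.mem_image.1 hy
        exact hc₁ x)
    have hva : ∀ c : ι₂ → ℤ, ∑ j, c j • v j ∈ B a := fun c =>
      AddSubgroup.sum_mem _ fun j _ => AddSubgroup.zsmul_mem _
        (hmono _ _ (Finset.le_sup (f := fun T : Finset κ => T.inf e) (htU j)) (hv j)) _
    refine ⟨ι₁ ⊕ ι₂, inferInstance, Sum.elim (fun _ => T) t, Sum.elim b v, ?_, ?_, ?_, ?_, ?_, ?_⟩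
    · rintro (i | j)
      · exact hTU
      · exact Finset.mem_of_mem_erase (htU j)
    · rintro (i | j)
      · exact hT
      · exact hess j
    · rintro (i | j)
      · exact hbT i
      · exact hv j
    · intro c hc
      rw [Fintype.sum_sum_type] at hc
      simp only [Sum.elim_inl, Sum.elim_inr] at hc
      have h1 := hbind (fun i => c (Sum.inl i)) (by
        rw [eq_neg_of_add_eq_zero_left hc]
        exact AddSubgroup.neg_mem _ (hva fun j => c (Sum.inr j)))
      rw [Finset.sum_eq_zero fun i _ => h1 i, zero_add] at hc
      rintro (i | j)
      · exact h1 i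
      · exact hind (fun j => c (Sum.inr j)) hc j
    · intro k c hc
      rw [Fintype.sum_sum_type] at hc
      simp only [Sum.elim_inl, Sum.elim_inr] at hc
      by_cases hk : k ∈ T
      · have h2 := (AddSubgroup.add_mem_cancel_left (B (e k)) (AddSubgroup.sum_mem _ fun i _ =>
          AddSubgroup.zsmul_mem _ (hmono _ _ (Finset.inf_le hk) (hbT i)) _)).1 hc
        rintro (i | j) hj
        · exact absurd hk hj
        · exact hadp k (fun j => c (Sum.inr j)) h2 j hj
      -- By distributivity: for `k ∉ T` the part `e k ⊓ T.inf e` is the meet over `insert k T`,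
      -- already below `a`. So elements of `B (e k)` have no component on the new generators.
      · have hle : e k ⊓ (T.inf e ⊔ a) ≤ a := by
          rw [inf_sup_left]
          refine sup_le ?_ inf_le_right
          rw [← Finset.inf_insert]
          exact Finset.le_sup (f := fun T : Finset κ => T.inf e)
            (hss _ (Finset.ssubset_insert hk))
        have hmem : ∑ i, c (Sum.inl i) • b i + ∑ j, c (Sum.inr j) • v j ∈ B a := by
          refine hmono _ _ hle ?_
          rw [hinf]
          refine ⟨hc, ?_⟩
          rw [hsup]
          exact AddSubgroup.add_mem_sup (AddSubgroup.sum_mem _ fun i _ =>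
            AddSubgroup.zsmul_mem _ (hbT i) _) (hva _)
        have h1 := hbind (fun i => c (Sum.inl i))
          ((AddSubgroup.add_mem_cancel_right _ (hva fun j => c (Sum.inr j))).1 hmem)
        rw [Finset.sum_eq_zero fun i _ => h1 i, zero_add] at hc
        rintro (i | j) hj
        · exact h1 i
        · exact hadp k (fun j => c (Sum.inr j)) hc j hj
    · intro x hx
      obtain ⟨c, hc⟩ := hspan _ (Finset.mem_image_of_mem _ (Finset.mem_univ ⟨x, hx⟩))
      refine ⟨Sum.elim (c₁ ⟨x, hx⟩) (-c), ?_⟩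
      rw [Fintype.sum_sum_type]
      simp only [Sum.elim_inl, Sum.elim_inr, Pi.neg_apply, neg_smul, Finset.sum_neg_distrib, hc]
      abel

/-- Given a lattice homomorphism `B` from a distributive lattice to pure subgroups of a torsion
abelian group, finitely many `x k ∈ B (e k)` are spanned by an independent family compatible with
`B`; every essential meet of the `e k` occurs as an index. -/
theorem exists_adapted_span (hG : IsAddTorsion G) (B : L → AddSubgroup G)
    (hsup : ∀ a b, B (a ⊔ b) = B a ⊔ B b) (hinf : ∀ a b, B (a ⊓ b) = B a ⊓ B b)
    (hbot : B ⊥ = ⊥)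
    (hpure : ∀ a, ∀ n : ℕ, 0 < n → ∀ y, n • y ∈ B a → ∃ z ∈ B a, n • z = n • y)
    (e : κ → L) (x : κ → G) (hx : ∀ k, x k ∈ B (e k)) :
    ∃ (m : ℕ) (t : Fin m → Finset κ) (v : Fin m → G) (c : κ → Fin m → ℤ),
      (∀ j, EssentialMeet e (t j)) ∧ (∀ T, EssentialMeet e T → ∃ j, t j = T) ∧
      (∀ j, v j ∈ B ((t j).inf e)) ∧
      (∀ c : Fin m → ℤ, ∑ j, c j • v j = 0 → ∀ j, c j • v j = 0) ∧
      (∀ k j, k ∉ t j → c k j • v j = 0) ∧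
      ∀ k, ∑ j, c k j • v j = x k := by
  classical
  have hmono : ∀ a b, a ≤ b → B a ≤ B b := by
    intro a b hab
    rw [← sup_eq_right.2 hab, hsup]
    exact le_sup_left
  obtain ⟨ι, _, t, v, -, hess, hv, hind, hadp, hspan⟩ :=
    exists_adapted_span_of_isUpperSet hG B hsup hinf hbot hpure e _ Finset.univ rfl
      (by rw [Finset.coe_univ]; exact isUpperSet_univ) (Finset.univ.image x) (by
        intro y hy
        obtain ⟨k, _, rfl⟩ := Finset.mem_image.1 hy
        refine hmono _ _ ?_ (hx k)
        refine le_trans ?_ (Finset.le_sup (Finset.mem_univ {k}))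
        rw [Finset.inf_singleton])
  choose c hc using fun k => hspan (x k) (Finset.mem_image_of_mem _ (Finset.mem_univ k))
  let κ' := {T : Finset κ // EssentialMeet e T}
  -- Zero vectors are added, one for each essential meet, so that all of these occur as indices;
  -- independence is unaffected.
  let ι' := ι ⊕ Fin (Fintype.card κ')
  let τ := (Fintype.equivFin κ').symm
  let ε : Fin (Fintype.card ι') ≃ ι' := (Fintype.equivFin ι').symm
  have hsum : ∀ d : ι' → ℤ, ∑ j, d j • (Sum.elim v 0 : ι' → G) j =
      ∑ j, d (Sum.inl j) • v j := by
    intro d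
    rw [Fintype.sum_sum_type]
    simp
  refine ⟨Fintype.card ι', fun j => Sum.elim t (fun i => (τ i).1) (ε j),
    fun j => (Sum.elim v 0 : ι' → G) (ε j), fun k j => (Sum.elim (c k) 0 : ι' → ℤ) (ε j),
    ?_, ?_, ?_, ?_, ?_, ?_⟩
  · intro j
    dsimp only
    rcases ε j with i | i
    · exact hess i
    · exact (τ i).2
  · intro T hT
    refine ⟨ε.symm (Sum.inr (τ.symm ⟨T, hT⟩)), ?_⟩
    simp
  · intro j
    dsimp only
    rcases ε j with i | i
    · exact hv i
    · exact zero_mem _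
  · intro d hd j
    have h1 : ∑ j, d (ε.symm j) • (Sum.elim v 0 : ι' → G) j = 0 := by
      rw [← hd, ← Equiv.sum_comp ε]
      simp
    rw [hsum] at h1
    have h2 := hind _ h1
    obtain ⟨i, rfl⟩ := ε.symm.surjective j
    rcases i with i | i
    · simpa using h2 i
    · simp
  · intro k j hkj
    dsimp only at hkj ⊢
    revert hkj
    rcases ε j with i | i <;> intro hkj
    · exact hadp k (c k) (by rw [hc]; exact hx k) i hkj
    · simp
  · intro k
    rw [Equiv.sum_comp ε fun j => (Sum.elim (c k) 0 : ι' → ℤ) j • (Sum.elim v 0 : ι' → G) j, hsum]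
    exact hc k

end EssentialMeets

/-! ### Levels, the Grothendieck group, and ideals of idempotents -/

section Levels

variable {M : Type u} [AddCommMonoid M]

theorem IsIdem.add {e f : M} (he : IsIdem e) (hf : IsIdem f) : IsIdem (e + f) := by
  unfold IsIdem
  rw [add_add_add_comm, he, hf]

theorem isIdem_zero : IsIdem (0 : M) := add_zero 0

/-- `x` lies in the maximal subgroup with zero element `e`. -/
def HasLevel (x e : M) : Prop := IsIdem e ∧ e + x = x ∧ ∃ y, x + y = e

theorem mem_component_iff {e x : M} (he : IsIdem e) : x ∈ component e ↔ HasLevel x e := by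
  constructor
  · rintro ⟨⟨z, rfl⟩, y, hy⟩
    exact ⟨he, by rw [← add_assoc, he], y, hy⟩
  · rintro ⟨-, h, y, hy⟩
    exact ⟨⟨x, h⟩, y, hy⟩

theorem IsIdem.hasLevel {e : M} (he : IsIdem e) : HasLevel e e := ⟨he, he, e, he⟩

namespace HasLevel

variable {x y e f : M}

theorem isIdem (h : HasLevel x e) : IsIdem e := h.1

theorem add (h : HasLevel x e) (h' : HasLevel y f) : HasLevel (x + y) (e + f) := by
  obtain ⟨he, hx, x', hx'⟩ := h
  obtain ⟨hf, hy, y', hy'⟩ := h'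
  exact ⟨he.add hf, by rw [add_add_add_comm, hx, hy], x' + y', by
    rw [add_add_add_comm, hx', hy']⟩

theorem unique (h : HasLevel x e) (h' : HasLevel x f) : e = f := by
  obtain ⟨he, hx, x', hx'⟩ := h
  obtain ⟨hf, hy, y', hy'⟩ := h'
  calc e = f + x + x' := by rw [hy, hx']
    _ = f + e := by rw [add_assoc, hx']
    _ = e + x + y' := by rw [add_assoc, hy', add_comm]
    _ = f := by rw [hx, hy']

theorem exists_inv (h : HasLevel x e) : ∃ y, HasLevel y e ∧ x + y = e := by
  obtain ⟨he, hx, x', hx'⟩ := h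
  have h1 : x + (x' + e) = e := by rw [← add_assoc, hx', he]
  refine ⟨x' + e, ⟨he, ?_, x, by rw [add_comm, h1]⟩, h1⟩
  rw [add_left_comm, he]

theorem nsmul (h : HasLevel x e) {n : ℕ} (hn : 0 < n) : HasLevel (n • x) e := by
  induction n, hn using Nat.le_induction with
  | base => simpa using h
  | succ n _ ih =>
    have := ih.add h
    rwa [h.isIdem, ← succ_nsmul] at this

/-- Summands of `e` have level below `e`. -/
theorem add_eq_of_add_eq (h : HasLevel x f) (hxy : x + y = e) : f + e = e := by
  rw [← hxy, ← add_assoc, h.2.1]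

end HasLevel

/-- The multiples of `x` form a cyclic group with zero `m • x`, in which `(m - 1) • x` is inverse to
`x`. -/
theorem hasLevel_nsmul_self {x : M} {m : ℕ} (hm : 0 < m) (h : (m + 1) • x = x) :
    HasLevel x (m • x) := by
  obtain ⟨k, rfl⟩ : ∃ k, m = k + 1 := ⟨m - 1, by omega⟩
  have h1 : (k + 1) • x + x = x := by rw [← succ_nsmul, h]
  have h2 : x + k • x = (k + 1) • x := (succ_nsmul' x k).symm
  refine ⟨?_, h1, k • x, h2⟩
  unfold IsIdem
  nth_rewrite 2 [← h2]
  rw [← add_assoc, h1, h2]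

theorem IsStronglyPeriodic.exists_level (h : IsStronglyPeriodic M) (x : M) :
    ∃ e, HasLevel x e := by
  obtain ⟨m, hm⟩ := h x
  exact ⟨_, hasLevel_nsmul_self m.pos hm⟩

theorem IsStronglyPeriodic.exists_nsmul_eq (h : IsStronglyPeriodic M) {x e : M}
    (hx : HasLevel x e) : ∃ n : ℕ, 0 < n ∧ n • x = e := by
  obtain ⟨m, hm⟩ := h x
  exact ⟨m, m.pos, (hasLevel_nsmul_self m.pos hm).unique hx⟩

open Algebra

/-- The canonical map to the Grothendieck group. -/
abbrev toGroup : M →+ GrothendieckAddGroup M := GrothendieckAddGroup.of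

theorem toGroup_eq_iff {x y : M} : toGroup x = toGroup y ↔ ∃ c, c + x = c + y := by
  refine (AddLocalization.addMonoidOf (⊤ : AddSubmonoid M)).eq_iff_exists.trans ?_
  simp

theorem IsIdem.toGroup_eq_zero {e : M} (he : IsIdem e) : toGroup e = 0 := by
  have := congrArg toGroup he
  rwa [map_add, add_eq_left] at this

theorem HasLevel.exists_neg {x e : M} (h : HasLevel x e) :
    ∃ y, HasLevel y e ∧ toGroup y = -toGroup x := by
  obtain ⟨y, hy, hxy⟩ := h.exists_inv
  refine ⟨y, hy, eq_neg_of_add_eq_zero_right ?_⟩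
  rw [← map_add, hxy, h.isIdem.toGroup_eq_zero]

theorem IsStronglyPeriodic.toGroup_surjective (h : IsStronglyPeriodic M) :
    Function.Surjective (toGroup : M → GrothendieckAddGroup M) := by
  intro g
  obtain ⟨⟨a, b⟩, hab⟩ := (AddLocalization.addMonoidOf (⊤ : AddSubmonoid M)).surj g
  obtain ⟨e, he⟩ := h.exists_level b.1
  obtain ⟨y, -, hy⟩ := he.exists_neg
  refine ⟨a + y, ?_⟩
  rw [map_add, hy, ← sub_eq_add_neg, sub_eq_iff_eq_add]
  exact hab.symm

theorem IsStronglyPeriodic.isAddTorsion (h : IsStronglyPeriodic M) :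
    IsAddTorsion (GrothendieckAddGroup M) := by
  intro g
  obtain ⟨x, rfl⟩ := h.toGroup_surjective g
  obtain ⟨e, he⟩ := h.exists_level x
  obtain ⟨n, hn, hx⟩ := h.exists_nsmul_eq he
  exact isOfFinAddOrder_iff_nsmul_eq_zero.2 ⟨n, hn, by
    rw [← map_nsmul, hx, he.isIdem.toGroup_eq_zero]⟩

/-- An element is determined by its level and its image in the Grothendieck group. -/
theorem IsRep.ext (h : IsRep M) {x y e : M} (hx : HasLevel x e) (hy : HasLevel y e)
    (hxy : toGroup x = toGroup y) : x = y := by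
  obtain ⟨c, hc⟩ := toGroup_eq_iff.1 hxy
  obtain ⟨g, hg⟩ := h.stronglyPeriodic.exists_level c
  obtain ⟨c', -, hcc'⟩ := hg.exists_inv
  have h1 : x + g = y + g := by
    rw [← hcc', ← add_assoc, ← add_assoc, add_comm x, add_comm y, hc]
  have he := hx.isIdem
  refine h.embedding e (e + g) he (he.add hg.isIdem) ⟨g, rfl⟩ ((mem_component_iff he).2 hx)
    ((mem_component_iff he).2 hy) ?_
  show x + (e + g) = y + (e + g)
  rw [add_left_comm, h1, add_left_comm]

/-- Purity carried over to the Grothendieck group: represent `g` by `a` and raise both sides to a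
common level, where the divisibility holds in `M` and (b) applies. -/
theorem IsRep.exists_nsmul_toGroup (h : IsRep M) {x e : M} (hx : HasLevel x e) {n : ℕ}
    (hn : 0 < n) {g : GrothendieckAddGroup M} (hg : n • g = toGroup x) :
    ∃ z, HasLevel z e ∧ n • toGroup z = toGroup x := by
  obtain ⟨a, rfl⟩ := h.stronglyPeriodic.toGroup_surjective g
  obtain ⟨a₀, ha⟩ := h.stronglyPeriodic.exists_level a
  have he := hx.isIdem
  have hf := he.add ha.isIdem
  have ha' : HasLevel (a + (e + a₀)) (e + a₀) := by
    have := ha.add hf.hasLevel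
    rwa [show a₀ + (e + a₀) = e + a₀ by rw [add_left_comm, ha.isIdem]] at this
  have hx' : HasLevel (x + (e + a₀)) (e + a₀) := by
    have := hx.add hf.hasLevel
    rwa [← add_assoc e, he] at this
  have heq : n • (a + (e + a₀)) = x + (e + a₀) := by
    refine h.ext (ha'.nsmul hn) hx' ?_
    rw [map_nsmul, map_add _ a, map_add _ x, hf.toGroup_eq_zero, add_zero, add_zero, hg]
  have hpure := (h.purity e (e + a₀) he hf ⟨a₀, rfl⟩).2 n hn
  have hmem : x + (e + a₀) ∈ (fun x => x + (e + a₀)) '' component e ∩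
      (fun y => n • y) '' component (e + a₀) :=
    ⟨⟨x, (mem_component_iff he).2 hx, rfl⟩, _, (mem_component_iff hf).2 ha', heq⟩
  rw [hpure] at hmem
  obtain ⟨_, ⟨z, hz, rfl⟩, hzx⟩ := hmem
  refine ⟨z, (mem_component_iff he).1 hz, ?_⟩
  have := congrArg toGroup hzx
  rwa [map_nsmul, map_add _ z, map_add _ x, hf.toGroup_eq_zero, add_zero, add_zero] at this

theorem IsRefinement.exists_add_of_hasLevel_add (h : IsRefinement M) {x e f : M}
    (he : IsIdem e) (hf : IsIdem f) (hx : HasLevel x (e + f)) :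
    ∃ a b, HasLevel a e ∧ HasLevel b f ∧ x = a + b := by
  obtain ⟨-, hx1, y, hy⟩ := hx
  obtain ⟨a, b, a', b', h1, -, h3, h4⟩ := h _ _ _ _ hy
  refine ⟨e + a, f + b, ⟨he, by rw [← add_assoc, he], a', ?_⟩,
    ⟨hf, by rw [← add_assoc, hf], b', ?_⟩, ?_⟩
  · rw [add_assoc, ← h3, he]
  · rw [add_assoc, ← h4, hf]
  · rw [add_add_add_comm, ← h1, hx1]

/-- The source of compatibility with meets. At level `e + f` the elements agree, `x + f = y + e`,
and refining this equation exhibits a summand common to `x` and `y`, and one common to `e` and `f`.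
-/
theorem IsRep.exists_common_level (h : IsRep M) {x y e f : M} (hx : HasLevel x e)
    (hy : HasLevel y f) (hxy : toGroup x = toGroup y) :
    ∃ d w, HasLevel w d ∧ d + e = e ∧ d + f = f ∧ toGroup w = toGroup x := by
  have he := hx.isIdem
  have hf := hy.isIdem
  have heq : x + f = y + e := by
    refine h.ext (hx.add hf.hasLevel) (by rw [add_comm e]; exact hy.add he.hasLevel) ?_
    rw [map_add, map_add, he.toGroup_eq_zero, hf.toGroup_eq_zero, hxy]
  obtain ⟨a, b, c, d, h1, h2, h3, h4⟩ := h.refinement _ _ _ _ heq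
  obtain ⟨a₀, ha⟩ := h.stronglyPeriodic.exists_level a
  obtain ⟨d₀, hd⟩ := h.stronglyPeriodic.exists_level d
  obtain ⟨x', -, hx'⟩ := hx.exists_inv
  obtain ⟨y', -, hy'⟩ := hy.exists_inv
  obtain ⟨d', hd', hdd⟩ := hd.exists_neg
  have h5 : a₀ + e = e := ha.add_eq_of_add_eq (y := b + x') (by rw [← add_assoc, ← h1, hx'])
  have h6 : a₀ + f = f := ha.add_eq_of_add_eq (y := c + y') (by rw [← add_assoc, ← h3, hy'])
  have h7 : d₀ + e = e := hd.add_eq_of_add_eq (y := b) (by rw [add_comm, ← h4])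
  have h8 : d₀ + f = f := hd.add_eq_of_add_eq (y := c) (by rw [add_comm, ← h2])
  refine ⟨a₀ + d₀, a + d', ha.add hd', by rw [add_assoc, h7, h5], by rw [add_assoc, h8, h6], ?_⟩
  have h9 : toGroup b + toGroup d = 0 := by rw [← map_add, ← h4, he.toGroup_eq_zero]
  rw [map_add, hdd, h1, map_add, eq_neg_of_add_eq_zero_left h9]

variable (M) in
/-- The idempotents of an abelian monoid, ordered by `e ≤ f ↔ e + f = f`. -/
@[ext]
structure Idem : Type u where
  val : M
  isIdem : IsIdem val

namespace Idem

instance : Max (Idem M) := ⟨fun e f => ⟨e.1 + f.1, e.2.add f.2⟩⟩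

instance : SemilatticeSup (Idem M) :=
  SemilatticeSup.mk' (fun _ _ => Idem.ext (add_comm _ _))
    (fun _ _ _ => Idem.ext (add_assoc _ _ _)) (fun e => Idem.ext e.2)

theorem le_iff {e f : Idem M} : e ≤ f ↔ e.1 + f.1 = f.1 := by
  rw [← sup_eq_right, Idem.ext_iff]
  rfl

instance : OrderBot (Idem M) where
  bot := ⟨0, isIdem_zero⟩
  bot_le _ := le_iff.2 (zero_add _)

end Idem

/-- The distributivity of the semilattice of idempotents. -/
theorem Idem.exists_sup_eq (hp : IsStronglyPeriodic M) (hr : IsRefinement M) {g e f : Idem M}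
    (h : g ≤ e ⊔ f) : ∃ e' f', e' ≤ e ∧ f' ≤ f ∧ e' ⊔ f' = g := by
  obtain ⟨a, b, a', b', h1, -, h3, h4⟩ := hr _ _ _ _ (Idem.le_iff.1 h)
  obtain ⟨a₀, ha⟩ := hp.exists_level a
  obtain ⟨b₀, hb⟩ := hp.exists_level b
  refine ⟨⟨a₀, ha.isIdem⟩, ⟨b₀, hb.isIdem⟩, Idem.le_iff.2 (ha.add_eq_of_add_eq h3.symm),
    Idem.le_iff.2 (hb.add_eq_of_add_eq h4.symm), Idem.ext ?_⟩
  have := ha.add hb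
  rw [← h1] at this
  exact this.unique g.2.hasLevel

theorem Idem.ideal_inf_sup_le (hp : IsStronglyPeriodic M) (hr : IsRefinement M)
    (I J K : Order.Ideal (Idem M)) : I ⊓ (J ⊔ K) ≤ I ⊓ J ⊔ I ⊓ K := by
  rintro g ⟨hI, hg⟩
  obtain ⟨j, hj, k, hk, hjk⟩ := Order.Ideal.mem_sup.1 hg
  obtain ⟨j', k', h1, h2, rfl⟩ := Idem.exists_sup_eq hp hr hjk
  exact Order.Ideal.mem_sup.2 ⟨j', ⟨I.lower le_sup_left hI, J.lower h1 hj⟩, k',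
    ⟨I.lower le_sup_right hI, K.lower h2 hk⟩, le_rfl⟩

/-- The subgroup of the Grothendieck group given by the elements with level in an ideal. -/
def levelSubgroup (I : Order.Ideal (Idem M)) : AddSubgroup (GrothendieckAddGroup M) where
  carrier := {g | ∃ e ∈ I, ∃ x, HasLevel x e.1 ∧ toGroup x = g}
  zero_mem' := ⟨⊥, I.bot_mem, 0, isIdem_zero.hasLevel, map_zero _⟩
  add_mem' := by
    rintro _ _ ⟨e, he, x, hx, rfl⟩ ⟨f, hf, y, hy, rfl⟩
    exact ⟨e ⊔ f, Order.Ideal.sup_mem he hf, x + y, hx.add hy, map_add _ _ _⟩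
  neg_mem' := by
    rintro _ ⟨e, he, x, hx, rfl⟩
    obtain ⟨y, hy, hxy⟩ := hx.exists_neg
    exact ⟨e, he, y, hy, hxy⟩

theorem levelSubgroup_mono {I J : Order.Ideal (Idem M)} (h : I ≤ J) :
    levelSubgroup I ≤ levelSubgroup J := by
  rintro g ⟨e, he, x⟩
  exact ⟨e, h he, x⟩

/-- Refinement splits an element of level `i + j` into elements of levels `i` and `j`. -/
theorem levelSubgroup_sup (hr : IsRefinement M) (I J : Order.Ideal (Idem M)) :
    levelSubgroup (I ⊔ J) = levelSubgroup I ⊔ levelSubgroup J := by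
  apply le_antisymm
  · rintro g ⟨e, he, x, hx, rfl⟩
    obtain ⟨i, hi, j, hj, hij⟩ := Order.Ideal.mem_sup.1 he
    have hx' : HasLevel (x + (i.1 + j.1)) (i.1 + j.1) := by
      have := hx.add (i ⊔ j).2.hasLevel
      rwa [Idem.le_iff.1 hij] at this
    obtain ⟨a, b, ha, hb, hab⟩ := hr.exists_add_of_hasLevel_add i.2 j.2 hx'
    have : toGroup x = toGroup a + toGroup b := by
      rw [← map_add, ← hab, map_add, (i.2.add j.2).toGroup_eq_zero, add_zero]
    rw [this]
    exact AddSubgroup.add_mem_sup ⟨i, hi, a, ha, rfl⟩ ⟨j, hj, b, hb, rfl⟩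
  · exact sup_le (levelSubgroup_mono le_sup_left) (levelSubgroup_mono le_sup_right)

theorem IsRep.levelSubgroup_inf (h : IsRep M) (I J : Order.Ideal (Idem M)) :
    levelSubgroup (I ⊓ J) = levelSubgroup I ⊓ levelSubgroup J := by
  apply le_antisymm
  · exact le_inf (levelSubgroup_mono inf_le_left) (levelSubgroup_mono inf_le_right)
  · rintro g ⟨⟨e, he, x, hx, rfl⟩, f, hf, y, hy, hxy⟩
    obtain ⟨d, w, hw, hde, hdf, hwx⟩ := h.exists_common_level hx hy hxy.symm
    exact ⟨⟨d, hw.isIdem⟩, ⟨I.lower (Idem.le_iff.2 hde) he, J.lower (Idem.le_iff.2 hdf) hf⟩,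
      w, hw, hwx⟩

theorem levelSubgroup_bot (hc : IsConical M) : levelSubgroup (⊥ : Order.Ideal (Idem M)) = ⊥ := by
  rw [eq_bot_iff]
  rintro g ⟨e, he, x, ⟨-, -, y, hy⟩, rfl⟩
  rw [← Order.Ideal.principal_bot, Order.Ideal.mem_principal, le_bot_iff] at he
  subst he
  rw [(hc x y hy).1, map_zero]
  exact zero_mem _

theorem IsRep.exists_nsmul_levelSubgroup (h : IsRep M) (I : Order.Ideal (Idem M)) (n : ℕ)
    (hn : 0 < n) (g : GrothendieckAddGroup M) (hg : n • g ∈ levelSubgroup I) :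
    ∃ z ∈ levelSubgroup I, n • z = n • g := by
  obtain ⟨e, he, x, hx, hxg⟩ := hg
  obtain ⟨z, hz, hzx⟩ := h.exists_nsmul_toGroup hx hn hxg.symm
  exact ⟨_, ⟨e, he, z, hz, rfl⟩, hzx.trans hxg⟩

end Levels

/-! ### Homomorphisms out of cyclic sums -/

section CyclicHom

variable {N : Type v} [AddCommMonoid N]

/-- The summand `n` on both sides avoids the coefficient zero: `0 • w` and `n • w` differ in
general. -/
theorem add_mul_nsmul {n : ℕ} {w : N} (hw : (n + 1) • w = w) (p k : ℕ) :
    (p + n + n * k) • w = (p + n) • w := by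
  induction k with
  | zero => simp
  | succ k ih =>
    have h1 : ∀ q, (q + n + n) • w = (q + n) • w := by
      intro q
      rcases Nat.eq_zero_or_pos n with rfl | hn
      · simp
      · obtain ⟨m, rfl⟩ : ∃ m, n = m + 1 := ⟨n - 1, by omega⟩
        rw [show q + (m + 1) + (m + 1) = (q + m) + (m + 1 + 1) by ring, add_smul, hw,
          ← succ_nsmul, add_assoc]
    rw [show p + n + n * (k + 1) = (p + n * k) + n + n by ring, h1,
      show p + n * k + n = p + n + n * k by ring, ih]

theorem nsmul_congr_mod {n : ℕ} {w : N} (hw : (n + 1) • w = w) (p : ℕ) :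
    (p % n + n) • w = (p + n) • w := by
  nth_rewrite 2 [← Nat.mod_add_div p n]
  rw [add_right_comm, add_mul_nsmul hw]

/-- The homomorphism on `(ℤ/nℤ) ⊔ {0}` with a given value at the generator. -/
noncomputable def cyclicHom (n : ℕ+) (w : N) (hw : ((n : ℕ) + 1) • w = w) :
    WithZero (ZMod (n : ℕ)) →+ N :=
  WithZero.lift
    -- Adding `n` sends the zero of `ZMod n` to the idempotent `n • w`, while the adjoined zero goes
    -- to `0`.
    { toFun := fun a => (a.val + n) • w
      map_add' := fun a b => by
        rw [ZMod.val_add, nsmul_congr_mod hw, ← add_smul,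
          show a.val + n + (b.val + n) = a.val + b.val + n + n * 1 by ring, add_mul_nsmul hw] }

theorem cyclicHom_coe (n : ℕ+) (w : N) (hw : ((n : ℕ) + 1) • w = w) (a : ZMod (n : ℕ)) :
    cyclicHom n w hw (a : WithZero (ZMod (n : ℕ))) = (a.val + n) • w := rfl

theorem cyclicHom_coe_one (n : ℕ+) (w : N) (hw : ((n : ℕ) + 1) • w = w) :
    cyclicHom n w hw ((1 : ZMod (n : ℕ)) : WithZero (ZMod (n : ℕ))) = w := by
  rw [cyclicHom_coe, ZMod.val_one_eq_one_mod, nsmul_congr_mod hw, add_comm, hw]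

theorem coe_nsmul_withZero {α : Type*} [AddMonoid α] (k : ℕ) (a : α) :
    (k + 1) • (a : WithZero α) = (((k + 1) • a : α) : WithZero α) := by
  induction k with
  | zero => simp
  | succ k ih => rw [succ_nsmul, ih, succ_nsmul _ (k + 1), WithZero.coe_add]

theorem succ_nsmul_coe {n : ℕ} {α : Type*} [AddMonoid α] {a : α} (h : n • a = 0) :
    (n + 1) • (a : WithZero α) = a := by
  rw [coe_nsmul_withZero, succ_nsmul, h, zero_add]

theorem succ_nsmul_withZero_zmod (n : ℕ) (a : WithZero (ZMod n)) : (n + 1) • a = a := by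
  induction a using WithZero.recZeroCoe with
  | zero => simp
  | coe a => exact succ_nsmul_coe (by simp)

theorem coe_eq_nsmul_coe_one (n : ℕ+) (a : ZMod (n : ℕ)) :
    (a : WithZero (ZMod (n : ℕ))) =
      (a.val + n) • ((1 : ZMod (n : ℕ)) : WithZero (ZMod (n : ℕ))) := by
  obtain ⟨k, hk⟩ : ∃ k, a.val + (n : ℕ) = k + 1 := ⟨a.val + n - 1, by have := n.pos; omega⟩
  rw [hk, coe_nsmul_withZero, ← hk]
  simp

theorem cyclic_hom_ext {n : ℕ+} {f g : WithZero (ZMod (n : ℕ)) →+ N}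
    (h : f ((1 : ZMod (n : ℕ)) : WithZero (ZMod (n : ℕ))) =
      g ((1 : ZMod (n : ℕ)) : WithZero (ZMod (n : ℕ)))) : f = g := by
  ext a
  induction a using WithZero.recZeroCoe with
  | zero => simp
  | coe a => rw [coe_eq_nsmul_coe_one, map_nsmul, map_nsmul, h]

variable {r : ℕ} {n : Fin r → ℕ+}

/-- The generator of the `k`-th summand. -/
def gen (n : Fin r → ℕ+) (k : Fin r) : CyclicSum n :=
  Pi.single k ((1 : ZMod (n k : ℕ)) : WithZero (ZMod (n k : ℕ)))

theorem succ_nsmul_gen (k : Fin r) : ((n k : ℕ) + 1) • gen n k = gen n k := by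
  rw [gen, ← Pi.single_smul, succ_nsmul_withZero_zmod]

theorem cyclicSum_hom_ext {f g : CyclicSum n →+ N} (h : ∀ k, f (gen n k) = g (gen n k)) :
    f = g := by
  refine AddMonoidHom.functions_ext' N _ _ fun k => cyclic_hom_ext ?_
  exact h k

/-- The homomorphism with given values at the generators. -/
noncomputable def cyclicSumHom (w : Fin r → N) (hw : ∀ k, ((n k : ℕ) + 1) • w k = w k) :
    CyclicSum n →+ N :=
  ∑ k, (cyclicHom (n k) (w k) (hw k)).comp (Pi.evalAddMonoidHom _ k)

theorem cyclicSumHom_apply (w : Fin r → N) (hw : ∀ k, ((n k : ℕ) + 1) • w k = w k)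
    (a : CyclicSum n) : cyclicSumHom w hw a = ∑ k, cyclicHom (n k) (w k) (hw k) (a k) := by
  simp [cyclicSumHom]

theorem cyclicSumHom_gen (w : Fin r → N) (hw : ∀ k, ((n k : ℕ) + 1) • w k = w k) (k : Fin r) :
    cyclicSumHom w hw (gen n k) = w k := by
  rw [cyclicSumHom_apply, Finset.sum_eq_single k]
  · rw [gen, Pi.single_eq_same, cyclicHom_coe_one]
  · intro j _ hj
    rw [gen, Pi.single_eq_of_ne hj, map_zero]
  · simp

end CyclicHom

/-! ### Levels and group images of values on cyclic sums -/

section Levels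

variable {M : Type u} [AddCommMonoid M] {r : ℕ} {n : Fin r → ℕ+}

theorem HasLevel.sum {ι : Type*} (s : Finset ι) {x e : ι → M} (h : ∀ i ∈ s, HasLevel (x i) (e i)) :
    HasLevel (∑ i ∈ s, x i) (∑ i ∈ s, e i) := by
  classical
  induction s using Finset.induction_on with
  | empty => exact isIdem_zero.hasLevel
  | insert a s ha ih =>
    rw [Finset.sum_insert ha, Finset.sum_insert ha]
    exact (h a (Finset.mem_insert_self _ _)).add
      (ih fun i hi => h i (Finset.mem_insert_of_mem hi))

-- The level of a value depends only on the support of the argument.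
open Classical in
theorem hasLevel_cyclicSumHom {w d : Fin r → M} (hw : ∀ k, ((n k : ℕ) + 1) • w k = w k)
    (hd : ∀ k, HasLevel (w k) (d k)) (a : CyclicSum n) :
    HasLevel (cyclicSumHom w hw a) (∑ k with a k ≠ 0, d k) := by
  rw [cyclicSumHom_apply, Finset.sum_filter]
  refine HasLevel.sum _ fun k _ => ?_
  split_ifs with h
  · obtain ⟨b, hb⟩ := WithZero.ne_zero_iff_exists.1 h
    rw [← hb, cyclicHom_coe]
    exact (hd k).nsmul (by have := (n k).pos; omega)
  · rw [not_not.1 h, map_zero]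
    exact isIdem_zero.hasLevel

theorem map_cyclicHom_intCast {G : Type*} [AddCommGroup G] (γ : M →+ G) {n : ℕ+} {w : M}
    (hw : ((n : ℕ) + 1) • w = w) (c : ℤ) :
    γ (cyclicHom n w hw ((c : ZMod (n : ℕ)) : WithZero (ZMod (n : ℕ)))) = c • γ w := by
  have h0 : (n : ℕ) • γ w = 0 := by
    have := congrArg γ hw
    rwa [map_nsmul, succ_nsmul, add_eq_right] at this
  rw [cyclicHom_coe, map_nsmul, add_smul, h0, add_zero, ← natCast_zsmul, ZMod.natCast_val,
    ZMod.coe_intCast]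
  conv_rhs => rw [← Int.emod_add_mul_ediv c n]
  rw [add_smul, mul_comm, mul_smul, natCast_zsmul, h0, smul_zero, add_zero]

end Levels

theorem exists_le_finset_sup {P ι : Type*} [SemilatticeSup P] [OrderBot P] (s : Finset ι)
    (I : ι → Order.Ideal P) {x : P} (hx : x ∈ s.sup I) :
    ∃ d : ι → P, (∀ i, d i ∈ I i) ∧ x ≤ s.sup d := by
  classical
  induction s using Finset.induction_on generalizing x with
  | empty =>
    rw [Finset.sup_empty, ← Order.Ideal.principal_bot, Order.Ideal.mem_principal] at hx
    exact ⟨fun _ => ⊥, fun i => (I i).bot_mem, hx⟩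
  | insert a s ha ih =>
    rw [Finset.sup_insert] at hx
    obtain ⟨y, hy, z, hz, hxyz⟩ := Order.Ideal.mem_sup.1 hx
    obtain ⟨d, hd, hzd⟩ := ih hz
    refine ⟨Function.update d a y, fun i => ?_, ?_⟩
    · rcases eq_or_ne i a with rfl | hi
      · simpa using hy
      · simpa [hi] using hd i
    · rw [Finset.sup_insert, Function.update_self]
      refine hxyz.trans (sup_le_sup_left (hzd.trans (le_of_eq ?_)) _)
      refine Finset.sup_congr rfl fun i hi => ?_
      rw [Function.update_of_ne (ne_of_mem_of_not_mem hi ha)]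

/-! ### Factoring homomorphisms through injective data -/

section Factorization

open Algebra

variable {M : Type u} [AddCommMonoid M]

theorem Idem.val_finset_sup {ι : Type*} (s : Finset ι) (e : ι → Idem M) :
    (s.sup e).val = ∑ i ∈ s, (e i).val := by
  classical
  induction s using Finset.induction_on with
  | empty => rfl
  | insert a s ha ih => rw [Finset.sup_insert, Finset.sum_insert ha, ← ih]; rfl

/-- Generators over which finitely many `x k` of level `e k` decompose independently. -/
theorem IsRep.exists_decomposition (h : IsRep M) {r : ℕ} (x : Fin r → M) (e : Fin r → Idem M)
    (hx : ∀ k, HasLevel (x k) (e k).val) :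
    ∃ (m : ℕ) (t : Fin m → Finset (Fin r)) (d : Fin m → Idem M) (w : Fin m → M)
      (c : Fin r → Fin m → ℤ),
      (∀ j, HasLevel (w j) (d j).val) ∧
      (∀ j k, k ∈ t j → ∀ S : Finset (Fin r), e k ≤ S.sup e → ∃ l ∈ S, l ∈ t j) ∧
      (∀ k, (Finset.univ.filter fun j => k ∈ t j).sup d = e k) ∧
      (∀ c : Fin m → ℤ, ∑ j, c j • toGroup (w j) = 0 → ∀ j, c j • toGroup (w j) = 0) ∧
      (∀ k j, k ∉ t j → c k j • toGroup (w j) = 0) ∧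
      ∀ k, ∑ j, c k j • toGroup (w j) = toGroup (x k) := by
  classical
  let _ : DistribLattice (Order.Ideal (Idem M)) :=
    DistribLattice.ofInfSupLe (Idem.ideal_inf_sup_le h.stronglyPeriodic h.refinement)
  set E : Fin r → Order.Ideal (Idem M) := fun k => Order.Ideal.principal (e k) with hE
  obtain ⟨m, t, v, c, hess, hcov, hv, hind, hadp, hspan⟩ :=
    exists_adapted_span h.stronglyPeriodic.isAddTorsion levelSubgroup
      (levelSubgroup_sup h.refinement) h.levelSubgroup_inf (levelSubgroup_bot h.conical)
      h.exists_nsmul_levelSubgroup E (fun k => toGroup (x k))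
      (fun k => ⟨e k, Order.Ideal.mem_principal.2 le_rfl, x k, hx k, rfl⟩)
  choose d₀ hd₀ w₀ hw₀ hv₀ using hv
  have hcover : ∀ k, ∃ d : Fin m → Idem M, (∀ j, d j ∈ (t j).inf E) ∧
      e k ≤ (Finset.univ.filter fun j => k ∈ t j).sup d := by
    intro k
    refine exists_le_finset_sup _ _ ?_
    have h1 : E k ≤ (Finset.univ.filter fun j => k ∈ t j).sup fun j => (t j).inf E := by
      have h2 := inf_le_sup_essentialMeet E {k}
      rw [Finset.inf_singleton] at h2
      refine h2.trans (Finset.sup_le fun T hT => ?_)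
      simp only [Finset.mem_filter, Finset.mem_univ, true_and, Finset.singleton_subset_iff] at hT
      obtain ⟨j, rfl⟩ := hcov T hT.2
      exact Finset.le_sup (f := fun j => (t j).inf E) (by simpa using hT.1)
    exact h1 (Order.Ideal.mem_principal.2 le_rfl)
  choose d₁ hd₁ hed₁ using hcover
  -- The levels of the generators are enlarged within the ideals `(t j).inf E`, without changing
  -- group images, until those with `k ∈ t j` join up to `e k`.
  let d : Fin m → Idem M := fun j => d₀ j ⊔ Finset.univ.sup fun k => d₁ k j
  have hd : ∀ j, d j ∈ (t j).inf E := by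
    intro j
    refine Order.Ideal.sup_mem (hd₀ j) ?_
    refine Finset.sup_induction (Order.Ideal.bot_mem _) (fun a ha b hb => Order.Ideal.sup_mem ha hb)
      fun k _ => hd₁ k j
  have hw : ∀ j, HasLevel (w₀ j + (d j).val) (d j).val := by
    intro j
    have := (hw₀ j).add (d j).isIdem.hasLevel
    rwa [Idem.le_iff.1 (le_sup_left : d₀ j ≤ d j)] at this
  have hwv : ∀ j, toGroup (w₀ j + (d j).val) = v j := by
    intro j
    rw [map_add, (d j).isIdem.toGroup_eq_zero, add_zero, hv₀]
  refine ⟨m, t, d, fun j => w₀ j + (d j).val, c, hw, ?_, ?_, ?_, ?_, ?_⟩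
  · intro j k hk S hS
    refine (hess j).exists_mem hk ?_
    rw [hE, Order.Ideal.principal_le_iff]
    refine Order.Ideal.lower _ hS ?_
    refine Finset.sup_induction (Order.Ideal.bot_mem _) (fun a ha b hb => Order.Ideal.sup_mem ha hb)
      fun l hl => ?_
    exact Finset.le_sup (f := E) hl (Order.Ideal.mem_principal.2 le_rfl)
  · intro k
    apply le_antisymm
    · refine Finset.sup_le fun j hj => ?_
      have hkj : k ∈ t j := by simpa using hj
      exact Order.Ideal.mem_principal.1 (Finset.inf_le (f := E) hkj (hd j))
    · refine (hed₁ k).trans (Finset.sup_mono_fun fun j _ => ?_)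
      exact (Finset.le_sup (f := fun k => d₁ k j) (Finset.mem_univ k)).trans le_sup_right
  · simpa only [hwv] using hind
  · simpa only [hwv] using hadp
  · simpa only [hwv] using hspan

theorem withZero_sum_eq_zero {α ι : Type*} [AddCommMonoid α] (s : Finset ι)
    (a : ι → WithZero α) : ∑ i ∈ s, a i = 0 ↔ ∀ i ∈ s, a i = 0 := by
  classical
  induction s using Finset.induction_on with
  | empty => simp
  | insert i s hi ih =>
    rw [Finset.sum_insert hi, Finset.forall_mem_insert, ← ih]
    generalize a i = p
    generalize ∑ i ∈ s, a i = q
    induction p using WithZero.recZeroCoe with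
    | zero => simp
    | coe p =>
      induction q using WithZero.recZeroCoe with
      | zero => simp
      | coe q =>
        rw [← WithZero.coe_add]
        simp only [WithZero.coe_ne_zero, false_and]

/-- A homomorphism from a finite direct sum of cyclic monoids factors through another one in such
a way that the first factor identifies all elements with the same image. -/
theorem IsRep.exists_factorization (h : IsRep M) {r : ℕ} {n : Fin r → ℕ+}
    (φ : CyclicSum n →+ M) :
    ∃ (m : ℕ) (n' : Fin m → ℕ+) (φ' : CyclicSum n' →+ M) (f : CyclicSum n →+ CyclicSum n'),
      φ'.comp f = φ ∧ (∀ a b, φ a = φ b → f a = f b) ∧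
      ∀ j, ∀ k : ℕ, (k + 1) • φ' (gen n' j) = φ' (gen n' j) → (n' j : ℕ) ∣ k := by
  classical
  have hx0 : ∀ k, ((n k : ℕ) + 1) • φ (gen n k) = φ (gen n k) := fun k => by
    rw [← map_nsmul, succ_nsmul_gen]
  have hx1 : ∀ k, HasLevel (φ (gen n k)) ((n k : ℕ) • φ (gen n k)) := fun k =>
    hasLevel_nsmul_self (n k).pos (hx0 k)
  let e : Fin r → Idem M := fun k => ⟨_, (hx1 k).isIdem⟩
  have hx2 : ∀ k, (n k : ℕ) • toGroup (φ (gen n k)) = 0 := fun k => by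
    rw [← map_nsmul]
    exact (e k).isIdem.toGroup_eq_zero
  obtain ⟨m, t, d, w, c, hw, ht, hd, hind, hadp, hspan⟩ :=
    h.exists_decomposition (fun k => φ (gen n k)) e hx1
  let n' : Fin m → ℕ+ := fun j =>
    ⟨addOrderOf (toGroup (w j)), (h.stronglyPeriodic.isAddTorsion (toGroup (w j))).addOrderOf_pos⟩
  have hn' : ∀ j (c : ℤ), (c : ZMod (n' j : ℕ)) = 0 ↔ c • toGroup (w j) = 0 := fun j c => by
    rw [ZMod.intCast_zmod_eq_zero_iff_dvd, ← addOrderOf_dvd_iff_zsmul_eq_zero]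
    rfl
  have hw' : ∀ j, ((n' j : ℕ) + 1) • w j = w j := fun j =>
    h.ext ((hw j).nsmul (Nat.succ_pos _)) (hw j) (by
      rw [map_nsmul, succ_nsmul]
      exact (congrArg (· + _) (addOrderOf_nsmul_eq_zero _)).trans (zero_add _))
  -- For `k ∈ t j` the entry lies in the group even when the coefficient vanishes modulo `n' j`: the
  -- support of `y k` must be all such `j` for its image to have level `e k`.
  let y : Fin r → CyclicSum n' := fun k j =>
    if k ∈ t j then ((c k j : ZMod (n' j : ℕ)) : WithZero (ZMod (n' j : ℕ))) else 0
  have hy0 : ∀ k j, y k j ≠ 0 ↔ k ∈ t j := fun k j => by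
    by_cases hk : k ∈ t j <;> simp [y, hk, WithZero.coe_ne_zero]
  have hy : ∀ k, ((n k : ℕ) + 1) • y k = y k := by
    intro k
    funext j
    rw [Pi.smul_apply]
    by_cases hk : k ∈ t j
    · simp only [y, if_pos hk]
      refine succ_nsmul_coe ?_
      have h1 := hind (fun j => ((n k : ℕ) : ℤ) * c k j) (by
        simp_rw [mul_smul, ← Finset.smul_sum, hspan, natCast_zsmul, hx2]) j
      rw [← hn'] at h1
      rw [nsmul_eq_mul]
      exact_mod_cast h1
    · simp [y, hk]
  let f := cyclicSumHom y hy
  let φ' := cyclicSumHom w hw'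
  have hφx : φ = cyclicSumHom (fun k => φ (gen n k)) hx0 :=
    cyclicSum_hom_ext fun k => (cyclicSumHom_gen (fun k => φ (gen n k)) hx0 k).symm
  have hcomp : φ'.comp f = φ := by
    refine cyclicSum_hom_ext fun k => ?_
    rw [AddMonoidHom.comp_apply, cyclicSumHom_gen]
    have hl := hasLevel_cyclicSumHom hw' hw (y k)
    have hs : ∑ j with y k j ≠ 0, (d j).val = (e k).val := by
      rw [← hd k, Idem.val_finset_sup]
      exact Finset.sum_congr (Finset.filter_congr fun j _ => hy0 k j) fun _ _ => rfl
    rw [hs] at hl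
    refine h.ext hl (hx1 k) ?_
    rw [← hspan, cyclicSumHom_apply, map_sum]
    refine Finset.sum_congr rfl fun j _ => ?_
    by_cases hk : k ∈ t j
    · simp only [y, if_pos hk]
      exact map_cyclicHom_intCast toGroup (hw' j) (c k j)
    · simp only [y, if_neg hk, map_zero, hadp k j hk]
  have hsupp : ∀ a j, f a j = 0 ↔ ∀ k, a k ≠ 0 → k ∉ t j := by
    intro a j
    rw [cyclicSumHom_apply, Finset.sum_apply, withZero_sum_eq_zero]
    simp only [Finset.mem_univ, true_imp_iff]
    refine forall_congr' fun k => ?_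
    by_cases hk : a k = 0
    · simp [hk]
    · obtain ⟨b, hb⟩ := WithZero.ne_zero_iff_exists.1 hk
      obtain ⟨q, hq⟩ : ∃ q, b.val + (n k : ℕ) = q + 1 :=
        ⟨b.val + n k - 1, by have := (n k).pos; omega⟩
      rw [← hb, cyclicHom_coe, hq, Pi.smul_apply]
      by_cases hkt : k ∈ t j
      · simp only [y, if_pos hkt, coe_nsmul_withZero]
        exact iff_of_false WithZero.coe_ne_zero fun h => h WithZero.coe_ne_zero hkt
      · simp [y, hkt]
  have hcoeff : ∀ j (z : WithZero (ZMod (n' j : ℕ))), ∃ β : ℤ,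
      (z ≠ 0 → z = ((β : ZMod (n' j : ℕ)) : WithZero (ZMod (n' j : ℕ)))) ∧
      toGroup (cyclicHom (n' j) (w j) (hw' j) z) = β • toGroup (w j) := by
    intro j z
    by_cases hz : z = 0
    · exact ⟨0, fun h => absurd hz h, by rw [hz, map_zero, map_zero, zero_smul]⟩
    · obtain ⟨b, rfl⟩ := WithZero.ne_zero_iff_exists.1 hz
      obtain ⟨β, rfl⟩ := ZMod.intCast_surjective b
      exact ⟨β, fun _ => rfl, map_cyclicHom_intCast toGroup (hw' j) β⟩
  refine ⟨m, n', φ', f, hcomp, ?_, ?_⟩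
  · intro a b hab
    -- Equal images have equal levels, so each `e k` with `k` in the support of `a` lies below the
    -- join over the support of `b`; essentiality then makes that support meet `t j`.
    have hsub : ∀ a b, φ a = φ b → ∀ j, f b j = 0 → f a j = 0 := by
      intro a b hab j hj
      rw [hsupp] at hj ⊢
      intro k hk hkt
      have h1 : (Finset.univ.filter fun k => a k ≠ 0).sup e =
          (Finset.univ.filter fun k => b k ≠ 0).sup e := by
        apply Idem.ext
        rw [Idem.val_finset_sup, Idem.val_finset_sup]
        have h2 := hasLevel_cyclicSumHom hx0 hx1 a
        have h3 := hasLevel_cyclicSumHom hx0 hx1 b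
        rw [← hφx] at h2 h3
        rw [hab] at h2
        exact h2.unique h3
      obtain ⟨l, hl, hlt⟩ := ht j k hkt _
        (h1 ▸ Finset.le_sup (f := e) (by simpa using hk))
      exact hj l (by simpa using hl) hlt
    choose α hα hα' using fun j => hcoeff j (f a j)
    choose β hβ hβ' using fun j => hcoeff j (f b j)
    have hsum : ∑ j, (α j - β j) • toGroup (w j) = 0 := by
      simp_rw [sub_smul, Finset.sum_sub_distrib, ← hα', ← hβ', ← map_sum]
      rw [← cyclicSumHom_apply, ← cyclicSumHom_apply, sub_eq_zero]
      congr 1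
      show (φ'.comp f) a = (φ'.comp f) b
      rw [hcomp, hab]
    funext j
    by_cases hz : f a j = 0
    · rw [hz, hsub b a hab.symm j hz]
    · rw [hα j hz, hβ j fun hb => hz (hsub a b hab j hb)]
      congr 1
      have := hind _ hsum j
      rwa [← hn', Int.cast_sub, sub_eq_zero] at this
  · intro j k hk
    rw [cyclicSumHom_gen] at hk
    refine addOrderOf_dvd_of_nsmul_eq_zero ?_
    have := congrArg toGroup hk
    rwa [map_nsmul, succ_nsmul, add_eq_right] at this

end Factorization

/-! ### The filtered category of cyclic sums over `M` -/

section ColimitConstruction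

open CategoryTheory

/-- A finite direct sum of cyclic monoids of orders dividing `𝔪`, with a homomorphism to `M`. -/
structure CyclicOver (𝔪 : GeneralizedInteger) (M : Type u) [AddCommMonoid M] : Type u where
  rank : ℕ
  order : Fin rank → ℕ+
  dvd : ∀ k, GeneralizedInteger.ofPNat (order k) ∣ 𝔪
  hom : CyclicSum order →+ M

namespace CyclicOver

variable {𝔪 : GeneralizedInteger} {M : Type u} [AddCommMonoid M]

/-- Morphisms are the homomorphisms over `M`; `ULift` puts them in the universe of the objects. -/
instance : SmallCategory (CyclicOver 𝔪 M) where
  Hom X Y := ULift.{u} {f : CyclicSum X.order →+ CyclicSum Y.order // Y.hom.comp f = X.hom}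
  id X := ⟨AddMonoidHom.id _, rfl⟩
  comp f g := ⟨g.down.1.comp f.down.1, by
    rw [← AddMonoidHom.comp_assoc, g.down.2, f.down.2]⟩

/-- The underlying homomorphism of a morphism. -/
def toHom {X Y : CyclicOver 𝔪 M} (f : X ⟶ Y) : CyclicSum X.order →+ CyclicSum Y.order := f.down.1

theorem hom_toHom {X Y : CyclicOver 𝔪 M} (f : X ⟶ Y) (a : CyclicSum X.order) :
    Y.hom (toHom f a) = X.hom a := DFunLike.congr_fun f.down.2 a

theorem toHom_comp {X Y Z : CyclicOver 𝔪 M} (f : X ⟶ Y) (g : Y ⟶ Z) (a : CyclicSum X.order) :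
    toHom (f ≫ g) a = toHom g (toHom f a) := rfl

theorem toHom_id (X : CyclicOver 𝔪 M) (a : CyclicSum X.order) : toHom (𝟙 X) a = a := rfl

theorem hom_ext {X Y : CyclicOver 𝔪 M} {f g : X ⟶ Y} (h : ∀ a, toHom f a = toHom g a) : f = g :=
  ULift.ext _ _ (Subtype.ext (DFunLike.ext _ _ h))

theorem exists_morphisms (X Y : CyclicOver 𝔪 M) :
    ∃ Z : CyclicOver 𝔪 M, Nonempty (X ⟶ Z) ∧ Nonempty (Y ⟶ Z) := by
  let n : Fin (X.rank + Y.rank) → ℕ+ := Fin.append X.order Y.order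
  let w : Fin (X.rank + Y.rank) → M :=
    Fin.append (fun k => X.hom (gen _ k)) (fun k => Y.hom (gen _ k))
  have hw : ∀ k, ((n k : ℕ) + 1) • w k = w k := by
    intro k
    induction k using Fin.addCases with
    | left k =>
      simp only [n, w, Fin.append_left]
      rw [← map_nsmul, succ_nsmul_gen]
    | right k =>
      simp only [n, w, Fin.append_right]
      rw [← map_nsmul, succ_nsmul_gen]
  have hn : ∀ k, GeneralizedInteger.ofPNat (n k) ∣ 𝔪 := by
    intro k
    induction k using Fin.addCases with
    | left k => simpa only [n, Fin.append_left] using X.dvd k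
    | right k => simpa only [n, Fin.append_right] using Y.dvd k
  refine ⟨⟨_, n, hn, cyclicSumHom w hw⟩,
    ⟨⟨cyclicSumHom (fun k => gen n (Fin.castAdd _ k)) fun k => ?_, ?_⟩⟩,
    ⟨⟨cyclicSumHom (fun k => gen n (Fin.natAdd _ k)) fun k => ?_, ?_⟩⟩⟩
  · simpa only [n, Fin.append_left] using succ_nsmul_gen (n := n) (Fin.castAdd _ k)
  · refine cyclicSum_hom_ext fun k => ?_
    rw [AddMonoidHom.comp_apply, cyclicSumHom_gen, cyclicSumHom_gen]
    exact Fin.append_left _ _ k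
  · simpa only [n, Fin.append_right] using succ_nsmul_gen (n := n) (Fin.natAdd _ k)
  · refine cyclicSum_hom_ext fun k => ?_
    rw [AddMonoidHom.comp_apply, cyclicSumHom_gen, cyclicSumHom_gen]
    exact Fin.append_right _ _ k

end CyclicOver

variable {𝔪 : GeneralizedInteger} {M : Type u} [AddCommMonoid M]

theorem ofPNat_dvd_of_dvd {a b : ℕ+} (h : (a : ℕ) ∣ b) (hb : GeneralizedInteger.ofPNat b ∣ 𝔪) :
    GeneralizedInteger.ofPNat a ∣ 𝔪 := by
  intro p
  refine le_trans ?_ (hb p)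
  exact Nat.cast_le.2 ((Nat.factorization_le_iff_dvd a.ne_zero b.ne_zero).2 h p)

/-- The orders produced by the factorization divide those of the images of the generators in `M`,
hence divide `𝔪`. -/
theorem CyclicOver.exists_kernel_eq (h : IsRep M)
    (h𝔪 : ∀ x : M, ∃ m : ℕ+, HasOrder x m ∧ GeneralizedInteger.ofPNat m ∣ 𝔪)
    (X : CyclicOver 𝔪 M) :
    ∃ (Y : CyclicOver 𝔪 M) (f : X ⟶ Y), ∀ a b, X.hom a = X.hom b → toHom f a = toHom f b := by
  obtain ⟨m, n', φ', f, hf, hker, hn'⟩ := h.exists_factorization X.hom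
  refine ⟨⟨m, n', fun j => ?_, φ'⟩, ⟨f, hf⟩, hker⟩
  obtain ⟨q, hq, hq𝔪⟩ := h𝔪 (φ' (gen n' j))
  exact ofPNat_dvd_of_dvd (hn' j q hq.1) hq𝔪

theorem CyclicOver.isFiltered (h : IsRep M)
    (h𝔪 : ∀ x : M, ∃ m : ℕ+, HasOrder x m ∧ GeneralizedInteger.ofPNat m ∣ 𝔪) :
    IsFiltered (CyclicOver 𝔪 M) where
  nonempty := ⟨⟨0, Fin.elim0, fun k => k.elim0, 0⟩⟩
  cocone_objs X Y := by
    obtain ⟨Z, ⟨f⟩, ⟨g⟩⟩ := exists_morphisms X Y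
    exact ⟨Z, f, g, trivial⟩
  cocone_maps X Y f g := by
    obtain ⟨Z, k, hk⟩ := Y.exists_kernel_eq h h𝔪
    refine ⟨Z, k, hom_ext fun a => ?_⟩
    rw [toHom_comp, toHom_comp]
    exact hk _ _ (by rw [hom_toHom, hom_toHom])

theorem IsRep.isDirectLimitOfCyclicSums (h : IsRep M)
    (h𝔪 : ∀ x : M, ∃ m : ℕ+, HasOrder x m ∧ GeneralizedInteger.ofPNat m ∣ 𝔪) :
    IsDirectLimitOfCyclicSums 𝔪 M := by
  have := CyclicOver.isFiltered h h𝔪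
  -- A final functor from a directed poset replaces the filtered category.
  obtain ⟨α, hα, hdi, hne, F, hF⟩ := IsFiltered.exists_directed (CyclicOver 𝔪 M)
  obtain ⟨hF₁, hF₂⟩ := (Functor.final_iff_of_isFiltered F).1 hF
  let f : ∀ i j : α, i ≤ j → CyclicSum (F.obj i).order →+ CyclicSum (F.obj j).order :=
    fun i j hij => CyclicOver.toHom (F.map (homOfLE hij))
  have hdir : DirectedSystem (fun i => CyclicSum (F.obj i).order) (fun i j h => f i j h) := by
    constructor
    · intro i x
      show CyclicOver.toHom (F.map (𝟙 i)) x = x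
      rw [F.map_id, CyclicOver.toHom_id]
    · intro k j i hij hjk x
      show CyclicOver.toHom _ (CyclicOver.toHom _ x) = _
      rw [← CyclicOver.toHom_comp, ← F.map_comp]
      rfl
  have hcompat : ∀ (i j : α) (hij : i ≤ j) (x : CyclicSum (F.obj i).order),
      (F.obj i).hom x = (F.obj j).hom (f i j hij x) :=
    fun i j hij x => (CyclicOver.hom_toHom _ x).symm
  refine ⟨α, hα, hne, hdi, fun i => (F.obj i).rank, fun i => (F.obj i).order, f, hdir,
    fun i => (F.obj i).dvd, ⟨AddEquiv.symm (AddEquiv.ofBijective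
      (⟨⟨DirectLimit.lift f (fun i => (F.obj i).hom) hcompat, ?_⟩, ?_⟩ :
        DirectLimit (fun i => CyclicSum (F.obj i).order) f →+ M) ⟨?_, ?_⟩)⟩⟩
  · exact DirectLimit.lift_zero (f := f) (fun i => (F.obj i).hom) hcompat
  · exact DirectLimit.lift_add (f := f) (fun i => (F.obj i).hom) hcompat
  · intro x y
    refine DirectLimit.induction₂ f (fun i a b hab => ?_) x y
    change (F.obj i).hom a = (F.obj i).hom b at hab
    obtain ⟨Y, k, hk⟩ := (F.obj i).exists_kernel_eq h h𝔪
    obtain ⟨j, ⟨g⟩⟩ := hF₁ Y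
    obtain ⟨j', hij, hjj⟩ := exists_ge_ge i j
    -- Finality makes the transition map agree, at a later stage, with a path through `k`, which has
    -- already identified `a` and `b`.
    obtain ⟨l, s, hs⟩ := hF₂ (F.map (homOfLE hij)) (k ≫ g ≫ F.map (homOfLE hjj))
    have hl : ∀ c, f i l (hij.trans s.le) c =
        CyclicOver.toHom (g ≫ F.map (homOfLE hjj) ≫ F.map s) (CyclicOver.toHom k c) := by
      intro c
      rw [← CyclicOver.toHom_comp]
      have : F.map (homOfLE (hij.trans s.le)) = k ≫ g ≫ F.map (homOfLE hjj) ≫ F.map s := by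
        rw [Category.assoc, Category.assoc] at hs
        rw [← hs, ← F.map_comp]
        rfl
      exact congrArg (fun q => CyclicOver.toHom q c) this
    exact Quotient.sound ⟨l, hij.trans s.le, hij.trans s.le, by
      rw [hl, hl, hk a b hab]⟩
  · intro x
    obtain ⟨m, hm, hm𝔪⟩ := h𝔪 x
    let X : CyclicOver 𝔪 M := ⟨1, fun _ => m, fun _ => hm𝔪, cyclicSumHom (fun _ => x) fun _ => hm.1⟩
    obtain ⟨j, ⟨g⟩⟩ := hF₁ X
    refine ⟨⟦⟨j, CyclicOver.toHom g (gen _ 0)⟩⟧, ?_⟩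
    show (F.obj j).hom _ = x
    rw [CyclicOver.hom_toHom]
    exact cyclicSumHom_gen _ _ 0

end ColimitConstruction

/-! ### Reduction of (b) to equations between elements -/

section Criterion

variable {M : Type u} [AddCommMonoid M]

/-- A criterion avoiding components and their images. -/
theorem IsRep.of_hasLevel (hp : IsStronglyPeriodic M) (hc : IsConical M) (hr : IsRefinement M)
    (hinj : ∀ x e f : M, HasLevel x e → IsIdem f → e + f = f → x + f = f → x = e)
    (hpure : ∀ x y e f : M, ∀ n : ℕ, 0 < n → HasLevel x e → HasLevel y f → e + f = f →
      x + f = n • y → ∃ z, HasLevel z e ∧ n • z = x) : IsRep M where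
  stronglyPeriodic := hp
  conical := hc
  refinement := hr
  embedding := by
    rintro e f he hf hef x hx y hy hxy
    rw [mem_component_iff he] at hx hy
    have hef' : e + f = f := by
      obtain ⟨z, rfl⟩ := hef
      rw [← add_assoc, he]
    change x + f = y + f at hxy
    obtain ⟨y', hy', hyy⟩ := hy.exists_inv
    have hlev : HasLevel (x + y') e := by
      have := hx.add hy'
      rwa [he] at this
    -- Injectivity comes from a trivial kernel, applied to the difference of `x` and `y`.
    have h1 := hinj (x + y') e f hlev hf hef' (by
      rw [add_right_comm, hxy, add_right_comm, hyy, hef'])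
    calc x = x + (y + y') := by rw [hyy, add_comm, hx.2.1]
      _ = x + y' + y := by rw [add_comm y, add_assoc]
      _ = y := by rw [h1, hy.2.1]
  purity := by
    rintro e f he hf hef
    have hef' : e + f = f := by
      obtain ⟨z, rfl⟩ := hef
      rw [← add_assoc, he]
    have hnf : ∀ n : ℕ, 0 < n → n • f = f := by
      intro n hn
      obtain ⟨k, rfl⟩ : ∃ k, n = k + 1 := ⟨n - 1, by omega⟩
      clear hn
      induction k with
      | zero => simp
      | succ k ih => rw [succ_nsmul, ih, hf]
    have hsub : (fun x => x + f) '' component e ⊆ component f := by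
      rintro _ ⟨x, hx, rfl⟩
      rw [mem_component_iff he] at hx
      rw [mem_component_iff hf]
      have := hx.add hf.hasLevel
      rwa [hef'] at this
    refine ⟨hsub, fun n hn => Set.Subset.antisymm ?_ ?_⟩
    · rintro _ ⟨⟨x, hx, rfl⟩, y, hy, hxy⟩
      rw [mem_component_iff he] at hx
      rw [mem_component_iff hf] at hy
      obtain ⟨z, hz, rfl⟩ := hpure x y e f n hn hx hy hef' hxy.symm
      refine ⟨z + f, ⟨z, (mem_component_iff he).2 hz, rfl⟩, ?_⟩
      show n • (z + f) = n • z + f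
      rw [nsmul_add, hnf n hn]
    · rintro _ ⟨y, hy, rfl⟩
      refine ⟨?_, y, hsub hy, rfl⟩
      obtain ⟨x, hx, rfl⟩ := hy
      refine ⟨n • x, ?_, ?_⟩
      · rw [mem_component_iff he] at hx ⊢
        exact hx.nsmul hn
      · show n • x + f = n • (x + f)
        rw [nsmul_add, hnf n hn]

end Criterion

/-! ### A group with a zero adjoined -/

section Cyclic

variable {A : Type*} [AddCommGroup A]

theorem withZero_eq_zero_or_coe {α : Type*} (x : WithZero α) : x = 0 ∨ ∃ a : α, x = a := by
  induction x using WithZero.recZeroCoe with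
  | zero => exact Or.inl rfl
  | coe a => exact Or.inr ⟨a, rfl⟩

theorem withZero_conical {x y : WithZero A} (h : x + y = 0) : x = 0 ∧ y = 0 := by
  rcases withZero_eq_zero_or_coe x with rfl | ⟨a, rfl⟩
  · exact ⟨rfl, by simpa using h⟩
  · rcases withZero_eq_zero_or_coe y with rfl | ⟨b, rfl⟩
    · simp [WithZero.coe_ne_zero] at h
    · rw [← WithZero.coe_add] at h
      exact absurd h WithZero.coe_ne_zero

theorem withZero_refinement (x₁ x₂ y₁ y₂ : WithZero A) (h : x₁ + x₂ = y₁ + y₂) :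
    ∃ z₁₁ z₁₂ z₂₁ z₂₂ : WithZero A,
      x₁ = z₁₁ + z₁₂ ∧ x₂ = z₂₁ + z₂₂ ∧ y₁ = z₁₁ + z₂₁ ∧ y₂ = z₁₂ + z₂₂ := by
  rcases withZero_eq_zero_or_coe x₁ with rfl | ⟨a, rfl⟩
  · exact ⟨0, 0, y₁, y₂, by simpa using h⟩
  rcases withZero_eq_zero_or_coe x₂ with rfl | ⟨b, rfl⟩
  · exact ⟨y₁, y₂, 0, 0, by simpa using h⟩
  rcases withZero_eq_zero_or_coe y₁ with rfl | ⟨c, rfl⟩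
  · exact ⟨0, a, 0, b, by simpa using h.symm⟩
  rcases withZero_eq_zero_or_coe y₂ with rfl | ⟨d, rfl⟩
  · exact ⟨a, 0, b, 0, by simpa using h.symm⟩
  rw [← WithZero.coe_add, ← WithZero.coe_add, WithZero.coe_inj] at h
  refine ⟨(c : A), ((a - c : A)), (0 : A), (b : A), ?_, ?_, ?_, ?_⟩ <;>
    rw [← WithZero.coe_add, WithZero.coe_inj]
  · abel
  · abel
  · abel
  · rw [sub_add_eq_add_sub, h]; abel

theorem withZero_eq_zero_of_hasLevel {x : WithZero A} (h : HasLevel x 0) : x = 0 := by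
  obtain ⟨-, -, y, hy⟩ := h
  exact (withZero_conical hy).1

theorem HasLevel.exists_withZero_coe {x : WithZero A} {e : A} (h : HasLevel x (e : WithZero A)) :
    e = 0 ∧ ∃ a : A, x = a := by
  obtain ⟨h1, h2, -⟩ := h
  constructor
  · have := WithZero.coe_inj.1 ((WithZero.coe_add e e).trans h1)
    simpa using this
  · rcases withZero_eq_zero_or_coe x with rfl | h
    · simp [WithZero.coe_ne_zero] at h2
    · exact h

theorem hasLevel_withZero_coe (a : A) : HasLevel (a : WithZero A) ((0 : A) : WithZero A) := by
  refine ⟨?_, ?_, ((-a : A)), ?_⟩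
  · unfold IsIdem
    rw [← WithZero.coe_add, add_zero]
  · rw [← WithZero.coe_add, zero_add]
  · rw [← WithZero.coe_add, add_neg_cancel]

theorem withZero_eq_of_hasLevel {x e f : WithZero A} (hx : HasLevel x e) (hf : IsIdem f)
    (hef : e + f = f) (hxf : x + f = f) : x = e := by
  rcases withZero_eq_zero_or_coe e with rfl | ⟨e, rfl⟩
  · exact withZero_eq_zero_of_hasLevel hx
  obtain ⟨rfl, a, rfl⟩ := hx.exists_withZero_coe
  rcases withZero_eq_zero_or_coe f with rfl | ⟨f, rfl⟩
  · simp [WithZero.coe_ne_zero] at hef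
  · rw [← WithZero.coe_add, WithZero.coe_inj, add_eq_right] at hxf
    rw [hxf]

/-- The only idempotents are the adjoined zero and the group zero. If `e` is the former, `x = 0`;
otherwise `e = f` and `y` itself serves. -/
theorem withZero_exists_nsmul {x y e f : WithZero A} {n : ℕ} (hn : 0 < n) (hx : HasLevel x e)
    (hy : HasLevel y f) (hef : e + f = f) (hxy : x + f = n • y) :
    ∃ z, HasLevel z e ∧ n • z = x := by
  obtain ⟨n, rfl⟩ : ∃ k, n = k + 1 := ⟨n - 1, by omega⟩
  rcases withZero_eq_zero_or_coe e with rfl | ⟨e, rfl⟩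
  · exact ⟨0, isIdem_zero.hasLevel, by rw [smul_zero, withZero_eq_zero_of_hasLevel hx]⟩
  obtain ⟨rfl, a, rfl⟩ := hx.exists_withZero_coe
  rcases withZero_eq_zero_or_coe f with rfl | ⟨f, rfl⟩
  · simp [WithZero.coe_ne_zero] at hef
  obtain ⟨rfl, b, rfl⟩ := hy.exists_withZero_coe
  refine ⟨b, hasLevel_withZero_coe b, ?_⟩
  rw [← hxy, ← WithZero.coe_add, add_zero]

end Cyclic

section Pi

variable {κ : Type*} {N : κ → Type*} [∀ k, AddCommMonoid (N k)]

theorem isIdem_pi {e : ∀ k, N k} : IsIdem e ↔ ∀ k, IsIdem (e k) := funext_iff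

theorem hasLevel_pi {x e : ∀ k, N k} : HasLevel x e ↔ ∀ k, HasLevel (x k) (e k) := by
  constructor
  · rintro ⟨h1, h2, y, h3⟩ k
    exact ⟨congrFun h1 k, congrFun h2 k, y k, congrFun h3 k⟩
  · intro h
    choose h1 h2 y h3 using h
    exact ⟨funext h1, funext h2, y, funext h3⟩

end Pi

/-! ### Cyclic sums, coordinate by coordinate -/

section CyclicSum

variable {r : ℕ} {n : Fin r → ℕ+}

theorem cyclicSum_conical {x y : CyclicSum n} (h : x + y = 0) : x = 0 ∧ y = 0 :=
  ⟨funext fun k => (withZero_conical (congrFun h k)).1,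
    funext fun k => (withZero_conical (congrFun h k)).2⟩

theorem cyclicSum_refinement : IsRefinement (CyclicSum n) := by
  intro x₁ x₂ y₁ y₂ h
  choose z₁₁ z₁₂ z₂₁ z₂₂ h1 h2 h3 h4 using fun k =>
    withZero_refinement (x₁ k) (x₂ k) (y₁ k) (y₂ k) (congrFun h k)
  exact ⟨z₁₁, z₁₂, z₂₁, z₂₂, funext h1, funext h2, funext h3, funext h4⟩

theorem cyclicSum_eq_of_hasLevel {x e f : CyclicSum n} (hx : HasLevel x e) (hf : IsIdem f)
    (hef : e + f = f) (hxf : x + f = f) : x = e :=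
  funext fun k => withZero_eq_of_hasLevel (hasLevel_pi.1 hx k) (isIdem_pi.1 hf k)
    (congrFun hef k) (congrFun hxf k)

theorem cyclicSum_exists_nsmul {x y e f : CyclicSum n} {m : ℕ} (hm : 0 < m) (hx : HasLevel x e)
    (hy : HasLevel y f) (hef : e + f = f) (hxy : x + f = m • y) :
    ∃ z, HasLevel z e ∧ m • z = x := by
  choose z hz hzx using fun k => withZero_exists_nsmul hm (hasLevel_pi.1 hx k)
    (hasLevel_pi.1 hy k) (congrFun hef k) (congrFun hxy k)
  exact ⟨z, hasLevel_pi.2 hz, funext hzx⟩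

theorem cyclicSum_succ_nsmul {m : ℕ} (hm : ∀ k, (n k : ℕ) ∣ m) (x : CyclicSum n) :
    (m + 1) • x = x := by
  funext k
  rw [Pi.smul_apply]
  obtain ⟨q, hq⟩ := hm k
  rcases withZero_eq_zero_or_coe (x k) with h | ⟨a, h⟩
  · rw [h, smul_zero]
  · rw [h]
    exact succ_nsmul_coe (by rw [hq, mul_comm, mul_smul]; simp)

end CyclicSum

section Order

variable {M : Type u} [AddCommMonoid M]

/-- Multiples of `x` with positive coefficient have period `k`, so a nonzero remainder of `m` modulo
`k` would contradict minimality. -/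
theorem exists_hasOrder {x : M} {m : ℕ} (hm : 0 < m) (h : (m + 1) • x = x) :
    ∃ k : ℕ+, HasOrder x k ∧ (k : ℕ) ∣ m := by
  classical
  have hex : ∃ k : ℕ, 0 < k ∧ (k + 1) • x = x := ⟨m, hm, h⟩
  obtain ⟨hk0, hk⟩ := Nat.find_spec hex
  have hmin : ∀ j, 0 < j → (j + 1) • x = x → Nat.find hex ≤ j := fun j h1 h2 =>
    Nat.find_min' hex ⟨h1, h2⟩
  generalize Nat.find hex = k at hk0 hk hmin
  refine ⟨⟨k, hk0⟩, ⟨hk, fun j hj => hmin j j.pos hj⟩, ?_⟩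
  rw [PNat.mk_coe, Nat.dvd_iff_mod_eq_zero]
  by_contra hne
  have hlt := Nat.mod_lt m hk0
  refine absurd (hmin _ (Nat.pos_of_ne_zero hne) ?_) (by omega)
  have hper : ∀ q j, (j + 1 + k * q) • x = (j + 1) • x := by
    intro q j
    induction q with
    | zero => simp
    | succ q ih =>
      rw [show j + 1 + k * (q + 1) = j + k * q + (k + 1) by ring, add_smul, hk, ← succ_nsmul, ← ih,
        add_right_comm]
  rw [← hper (m / k), add_right_comm, Nat.mod_add_div, h]

end Order

/-! ### Passing the conditions to direct limits -/

section ColimitProperties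

variable {𝔪 : GeneralizedInteger} {M : Type u} [AddCommMonoid M]

/-- Finitely many elements of a direct limit of cyclic sums lift to one stage, and finitely many
equations between them hold at a later stage. -/
theorem IsDirectLimitOfCyclicSums.exists_stages (h : IsDirectLimitOfCyclicSums 𝔪 M) :
    ∃ (ι : Type u) (r : ι → ℕ) (n : ∀ i, Fin (r i) → ℕ+) (φ : ∀ i, CyclicSum (n i) →+ M),
      (∀ i k, GeneralizedInteger.ofPNat (n i k) ∣ 𝔪) ∧
      (∀ (q : ℕ) (x : Fin q → M), ∃ (i : ι) (a : Fin q → CyclicSum (n i)),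
        ∀ k, φ i (a k) = x k) ∧
      ∀ i (l : List (CyclicSum (n i) × CyclicSum (n i))), (∀ p ∈ l, φ i p.1 = φ i p.2) →
        ∃ (j : ι) (g : CyclicSum (n i) →+ CyclicSum (n j)),
          (∀ a, φ j (g a) = φ i a) ∧ ∀ p ∈ l, g p.1 = g p.2 := by
  obtain ⟨ι, hι, hne, hdi, r, n, f, hf, hn, ⟨e⟩⟩ := h
  let L := DirectLimit (fun i => CyclicSum (n i)) f
  let φ : ∀ i, CyclicSum (n i) →+ M := fun i => e.symm.toAddMonoidHom.comp
    { toFun := fun a => (⟦⟨i, a⟩⟧ : L)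
      map_zero' := (DirectLimit.zero_def (f := f) i).symm
      map_add' := fun a b => (DirectLimit.add_def (f := f) i a b).symm }
  have hφ : ∀ i a, φ i a = e.symm (⟦⟨i, a⟩⟧ : L) := fun _ _ => rfl
  have hφf : ∀ i j hij a, φ j (f i j hij a) = φ i a := by
    intro i j hij a
    rw [hφ, hφ]
    exact congrArg e.symm (DirectLimit.mk_apply (f := f) i j a hij)
  refine ⟨ι, r, n, φ, hn, ?_, ?_⟩
  · intro q x
    have h1 : ∀ k, ∃ i a, φ i a = x k := by
      intro k
      obtain ⟨i, a, ha⟩ := DirectLimit.exists_eq_mk f (e (x k))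
      exact ⟨i, a, by rw [hφ, ← ha, e.symm_apply_apply]⟩
    choose i a ha using h1
    obtain ⟨j, hj⟩ := Finite.exists_le i
    exact ⟨j, fun k => f _ _ (hj k) (a k), fun k => by rw [hφf, ha]⟩
  · intro i l hl
    induction l with
    | nil => exact ⟨i, AddMonoidHom.id _, fun _ => rfl, by simp⟩
    | cons p l ih =>
      obtain ⟨j, g, hg, hgl⟩ := ih fun q hq => hl q (List.mem_cons_of_mem _ hq)
      have hp : φ j (g p.1) = φ j (g p.2) := by
        rw [hg, hg]
        exact hl p List.mem_cons_self
      rw [hφ, hφ, e.symm.injective.eq_iff] at hp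
      obtain ⟨k, hjk, _, hk⟩ := Quotient.exact hp
      refine ⟨k, (f j k hjk).comp g, fun a => (hφf j k hjk (g a)).trans (hg a), ?_⟩
      intro q hq
      rcases List.mem_cons.1 hq with rfl | hq
      · exact hk
      · rw [AddMonoidHom.comp_apply, AddMonoidHom.comp_apply, hgl q hq]

theorem HasLevel.map {N : Type*} [AddCommMonoid N] (φ : M →+ N) {x e : M} (h : HasLevel x e) :
    HasLevel (φ x) (φ e) := by
  obtain ⟨h1, h2, y, h3⟩ := h
  refine ⟨?_, by rw [← map_add, h2], φ y, by rw [← map_add, h3]⟩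
  unfold IsIdem
  rw [← map_add, h1]

theorem exists_common_order_dvd {r : ℕ} {n : Fin r → ℕ+}
    (hn : ∀ k, GeneralizedInteger.ofPNat (n k) ∣ 𝔪) :
    ∃ m : ℕ+, (∀ k, (n k : ℕ) ∣ m) ∧ GeneralizedInteger.ofPNat m ∣ 𝔪 := by
  suffices H : ∀ s : Finset (Fin r), ∃ m : ℕ+, (∀ k ∈ s, (n k : ℕ) ∣ m) ∧
      GeneralizedInteger.ofPNat m ∣ 𝔪 by
    obtain ⟨m, h1, h2⟩ := H Finset.univ
    exact ⟨m, fun k => h1 k (Finset.mem_univ k), h2⟩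
  intro s
  induction s using Finset.induction_on with
  | empty =>
    refine ⟨1, by simp, fun p => ?_⟩
    simp [GeneralizedInteger.ofPNat, GeneralizedInteger.exponent]
  | insert k s _ ih =>
    obtain ⟨m, h1, h2⟩ := ih
    refine ⟨PNat.lcm (n k) m, ?_, fun p => ?_⟩
    · intro l hl
      rw [PNat.lcm_coe]
      rcases Finset.mem_insert.1 hl with rfl | hl
      · exact Nat.dvd_lcm_left _ _
      · exact (h1 l hl).trans (Nat.dvd_lcm_right _ _)
    · have h3 := hn k p
      have h4 := h2 p
      simp only [GeneralizedInteger.ofPNat, GeneralizedInteger.exponent] at h3 h4 ⊢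
      rw [PNat.lcm_coe, Nat.factorization_lcm (n k).ne_zero m.ne_zero, Finsupp.sup_apply]
      rcases le_total ((n k : ℕ).factorization p) ((m : ℕ).factorization p) with h | h
      · rwa [sup_eq_right.2 h]
      · rwa [sup_eq_left.2 h]

theorem IsDirectLimitOfCyclicSums.exists_hasOrder (h : IsDirectLimitOfCyclicSums 𝔪 M) (x : M) :
    ∃ m : ℕ+, HasOrder x m ∧ GeneralizedInteger.ofPNat m ∣ 𝔪 := by
  obtain ⟨ι, r, n, φ, hn, hlift, -⟩ := h.exists_stages
  obtain ⟨i, a, ha⟩ := hlift 1 fun _ => x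
  obtain ⟨m, hm, hm𝔪⟩ := exists_common_order_dvd (hn i)
  have h1 := congrArg (φ i) (cyclicSum_succ_nsmul hm (a 0))
  rw [map_nsmul, ha] at h1
  obtain ⟨k, hk, hkm⟩ := AbelianMonoid.exists_hasOrder m.pos h1
  exact ⟨k, hk, ofPNat_dvd_of_dvd hkm hm𝔪⟩

theorem IsDirectLimitOfCyclicSums.isRep (h : IsDirectLimitOfCyclicSums 𝔪 M) : IsRep M := by
  obtain ⟨ι, r, n, φ, -, hlift, heq⟩ := h.exists_stages
  refine IsRep.of_hasLevel (fun x => ?_) ?_ ?_ ?_ ?_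
  · obtain ⟨m, hm, -⟩ := h.exists_hasOrder x
    exact ⟨m, hm.1⟩
  · intro x y hxy
    obtain ⟨i, a, ha⟩ := hlift 2 ![x, y]
    obtain ⟨j, g, hg, hgl⟩ := heq i [(a 0 + a 1, 0)] (by simp [ha, hxy])
    have hx : φ i (a 0) = x := ha 0
    have hy : φ i (a 1) = y := ha 1
    have h1 : g (a 0) + g (a 1) = 0 := by simpa using hgl
    obtain ⟨h2, h3⟩ := cyclicSum_conical h1
    rw [← hx, ← hy, ← hg, ← hg, h2, h3, map_zero]
    exact ⟨rfl, rfl⟩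
  · intro x₁ x₂ y₁ y₂ hxy
    obtain ⟨i, a, ha⟩ := hlift 4 ![x₁, x₂, y₁, y₂]
    have h0 : φ i (a 0) = x₁ := ha 0
    have h1 : φ i (a 1) = x₂ := ha 1
    have h2 : φ i (a 2) = y₁ := ha 2
    have h3 : φ i (a 3) = y₂ := ha 3
    obtain ⟨j, g, hg, hgl⟩ := heq i [(a 0 + a 1, a 2 + a 3)] (by simp [h0, h1, h2, h3, hxy])
    have h4 : g (a 0) + g (a 1) = g (a 2) + g (a 3) := by simpa using hgl
    obtain ⟨z₁, z₂, z₃, z₄, h5, h6, h7, h8⟩ := cyclicSum_refinement _ _ _ _ h4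
    refine ⟨φ j z₁, φ j z₂, φ j z₃, φ j z₄, ?_, ?_, ?_, ?_⟩
    · rw [← map_add, ← h5, hg, h0]
    · rw [← map_add, ← h6, hg, h1]
    · rw [← map_add, ← h7, hg, h2]
    · rw [← map_add, ← h8, hg, h3]
  · rintro x e f ⟨he, hx, x', hx'⟩ hf hef hxf
    obtain ⟨i, a, ha⟩ := hlift 4 ![x, e, f, x']
    have h0 : φ i (a 0) = x := ha 0
    have h1 : φ i (a 1) = e := ha 1
    have h2 : φ i (a 2) = f := ha 2
    have h3 : φ i (a 3) = x' := ha 3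
    -- The first three equations make the image of `a 0` have level that of `a 1`, with `a 3` as
    -- witness; the others are the hypotheses on `f`.
    obtain ⟨j, g, hg, hgl⟩ := heq i [(a 1 + a 1, a 1), (a 1 + a 0, a 0), (a 0 + a 3, a 1),
      (a 2 + a 2, a 2), (a 1 + a 2, a 2), (a 0 + a 2, a 2)] (by
        simpa [h0, h1, h2, h3] using ⟨he, hx, hx', hf, hef, hxf⟩)
    simp only [List.forall_mem_cons, map_add] at hgl
    obtain ⟨g1, g2, g3, g4, g5, g6, -⟩ := hgl
    have := cyclicSum_eq_of_hasLevel ⟨g1, g2, _, g3⟩ g4 g5 g6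
    rw [← h0, ← h1, ← hg, ← hg, this]
  · rintro x y e f m hm ⟨he, hx, x', hx'⟩ ⟨hf, hy, y', hy'⟩ hef hxy
    obtain ⟨i, a, ha⟩ := hlift 6 ![x, e, f, x', y, y']
    have h0 : φ i (a 0) = x := ha 0
    have h1 : φ i (a 1) = e := ha 1
    have h2 : φ i (a 2) = f := ha 2
    have h3 : φ i (a 3) = x' := ha 3
    have h4 : φ i (a 4) = y := ha 4
    have h5 : φ i (a 5) = y' := ha 5
    obtain ⟨j, g, hg, hgl⟩ := heq i [(a 1 + a 1, a 1), (a 1 + a 0, a 0), (a 0 + a 3, a 1),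
      (a 2 + a 2, a 2), (a 2 + a 4, a 4), (a 4 + a 5, a 2), (a 1 + a 2, a 2),
      (a 0 + a 2, m • a 4)] (by
        simpa [h0, h1, h2, h3, h4, h5, -nsmul_eq_mul] using ⟨he, hx, hx', hf, hy, hy', hef, hxy⟩)
    simp only [List.forall_mem_cons, map_add, map_nsmul] at hgl
    obtain ⟨g1, g2, g3, g4, g5, g6, g7, g8, -⟩ := hgl
    obtain ⟨z, hz, hzx⟩ := cyclicSum_exists_nsmul hm ⟨g1, g2, _, g3⟩ ⟨g4, g5, _, g6⟩ g7 g8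
    refine ⟨φ j z, ?_, ?_⟩
    · have := hz.map (φ j)
      rwa [hg, h1] at this
    · rw [← map_nsmul, hzx, hg, h0]

end ColimitProperties

end AbelianMonoid

theorem corollary5p4 (𝔪 : GeneralizedInteger) (M : Type u) [AddCommMonoid M] :
    AbelianMonoid.IsDirectLimitOfCyclicSums 𝔪 M ↔
      AbelianMonoid.IsRep M ∧
        ∀ x : M, ∃ m : ℕ+, AbelianMonoid.HasOrder x m ∧ GeneralizedInteger.ofPNat m ∣ 𝔪 :=
  ⟨fun h => ⟨h.isRep, h.exists_hasOrder⟩, fun h => h.1.isDirectLimitOfCyclicSums h.2⟩
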